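/- Let $d\ge1$ be an integer. For an integer $q\ge1$ (the number of spin states) and a density $\rho\in L^1(\mathbb{R}^d,\mathbb{R}_+)$ with $\sqrt\rho\in H^1(\mathbb{R}^d)$, let $$T(\rho):=\inf\big\{\mathrm{Tr}\,(-\Delta)\gamma\;:\;\gamma=\gamma^*\text{ on }L^2(\mathbb{R}^d,\mathbb{C}^q),\ 0\le\gamma\le1,\ \rho_\gamma=\rho\big\}$$ be the lowest kinetic energy of fermionic one-particle density matrices $\gamma$ with density $\rho$. Here $\rho_\gamma(x)=\sum_{\sigma=1}^q\gamma(x,\sigma;x,\sigma)$ is the diagonal of the integral kernel of $\gamma$ summed over the spin, and $\mathrm{Tr}\,(-\Delta)\gamma=\mathrm{Tr}\,\sqrt\gamma(-\Delta)\sqrt\gamma\in[0,\infty]$ is understood through the quadratic form $u\mapsto\int_{\mathbb{R}^d}|\nabla u|^2$. Let $$c_{\rm TF}=\frac{4\pi^2d}{d+2}\left(\frac{d}{|\mathbb{S}^{d-1}|}\right)^{2/d}$$ be the Thomas–Fermi constant, where $|\mathbb{S}^{d-1}|$ is the surface area of the unit sphere of $\mathbb{R}^d$. Then there are two constants $\kappa_1,\kappa_2>0$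 depending only on the space dimension $d$ such that $$T(\rho)\le q^{-2/d}c_{\rm TF}(1+\kappa_1\varepsilon)\int_{\mathbb{R}^d}\rho(x)^{1+2/d}\,dx+\frac{\kappa_2(1+\sqrt\varepsilon)^2}{\varepsilon}\int_{\mathbb{R}^d}|\nabla\sqrt\rho(x)|^2\,dx$$ for every $q\ge1$, every $\rho\in L^1(\mathbb{R}^d,\mathbb{R}_+)$ with $\sqrt\rho\in H^1(\mathbb{R}^d)$ and every $\varepsilon>0$. -/

import Mathlib

open MeasureTheory
open scoped ENNReal ContDiff

noncomputable section

/-- Euclidean space `ℝ^d`. -/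
abbrev Space (d : ℕ) : Type := EuclideanSpace ℝ (Fin d)

/-- The one-particle Hilbert space `L²(ℝ^d, ℂ^q)` of particles with `q` spin states. -/
abbrev OneParticle (d q : ℕ) : Type :=
  Lp (EuclideanSpace ℂ (Fin q)) 2 (volume : Measure (Space d))

/-- `v` is the weak partial derivative `∂_j u` on `ℝ^d`: both functions are locally integrable and
`∫ (∂_j φ) u = - ∫ φ v` for every real-valued test function `φ ∈ C_c^∞(ℝ^d)`. -/
structure HasWeakPartialDeriv {d : ℕ} {F : Type*} [NormedAddCommGroup F] [NormedSpace ℝ F]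
    (j : Fin d) (u v : Space d → F) : Prop where
  locallyIntegrable : LocallyIntegrable u volume
  locallyIntegrable_deriv : LocallyIntegrable v volume
  integral_eq : ∀ φ : Space d → ℝ, ContDiff ℝ ∞ φ → HasCompactSupport φ →
    ∫ x, (fderiv ℝ φ x (EuclideanSpace.single j 1)) • u x = - ∫ x, φ x • v x

/-- The Sobolev space `H¹(ℝ^d)`: square-integrable functions whose weak partial derivatives exist
and are square-integrable. -/
def MemH1 {d : ℕ} {F : Type*} [NormedAddCommGroup F] [NormedSpace ℝ F]
    (u : Space d → F) : Prop :=
  MemLp u 2 volume ∧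
    ∃ v : Fin d → Space d → F, ∀ j, HasWeakPartialDeriv j u (v j) ∧ MemLp (v j) 2 volume

/-- The Dirichlet integral `∫ |∇u|² = ∑_j ∫ |∂_j u|² ∈ [0, ∞]`, with value `∞` if `u` has no weak
gradient. The weak gradient is unique almost everywhere, so the infimum only selects it. -/
def dirichletEnergy {d : ℕ} {F : Type*} [NormedAddCommGroup F] [NormedSpace ℝ F]
    (u : Space d → F) : ℝ≥0∞ :=
  ⨅ (v : Fin d → Space d → F) (_ : ∀ j, HasWeakPartialDeriv j u (v j)),
    ∑ j, ∫⁻ x, ‖v j x‖ₑ ^ 2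

/-- An orthonormal basis of `L²(ℝ^d, ℂ^q)`. The traces below are traces of nonnegative operators
and do not depend on its choice. -/
def oneParticleBasis (d q : ℕ) :
    HilbertBasis ↥(Classical.choose (exists_hilbertBasis ℂ (OneParticle d q))) ℂ (OneParticle d q) :=
  Classical.choose (Classical.choose_spec (exists_hilbertBasis ℂ (OneParticle d q)))

/-- The nonnegative square root `√γ` of a nonnegative bounded operator `γ` on a Hilbert space. -/
def opSqrt {H : Type*} [NormedAddCommGroup H] [InnerProductSpace ℂ H] [CompleteSpace H]
    (γ : H →L[ℂ] H) : H →L[ℂ] H :=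
  CFC.sqrt γ

/-- The density `ρ_γ(x) = ∑_σ γ(x,σ;x,σ)` of a nonnegative bounded operator `γ`, that is, the
diagonal of the kernel `γ(x,σ;y,τ) = ∑_i (√γ e_i)(x,σ) (√γ e_i)(y,τ)^*` summed over the spin.
Equivalently, `∫_A ρ_γ = Tr (√γ 1_A √γ)` for every measurable `A`. -/
def density {d q : ℕ} (γ : OneParticle d q →L[ℂ] OneParticle d q) (x : Space d) : ℝ≥0∞ :=
  ∑' i, ‖(opSqrt γ (oneParticleBasis d q i) : OneParticle d q) x‖ₑ ^ 2

/-- The kinetic energy `Tr (-Δ)γ = Tr (√γ (-Δ) √γ) = ∑_i ∫ |∇ √γ e_i|² ∈ [0, ∞]` of a nonnegative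
bounded operator `γ`, where `-Δ` is understood as the quadratic form `u ↦ ∫ |∇u|²`. -/
def kineticEnergy {d q : ℕ} (γ : OneParticle d q →L[ℂ] OneParticle d q) : ℝ≥0∞ :=
  ∑' i, dirichletEnergy (opSqrt γ (oneParticleBasis d q i) : OneParticle d q)

/-- The lowest kinetic energy `T(ρ)`: the infimum of `Tr (-Δ)γ` over all self-adjoint operators `γ`
on `L²(ℝ^d, ℂ^q)` with `0 ≤ γ ≤ 1` (in the sense of quadratic forms) and `ρ_γ = ρ` almost
everywhere. It is `∞` if there is no such `γ`. -/
def lowestKineticEnergy {d : ℕ} (q : ℕ) (ρ : Space d → ℝ) : ℝ≥0∞ :=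
  ⨅ (γ : OneParticle d q →L[ℂ] OneParticle d q) (_ : 0 ≤ γ) (_ : γ ≤ 1)
    (_ : density γ =ᵐ[volume] fun x => ENNReal.ofReal (ρ x)), kineticEnergy γ

/-- The surface area `|𝕊^{d-1}|` of the unit sphere of `ℝ^d` (equal to `2` if `d = 1`). -/
def sphereArea (d : ℕ) : ℝ :=
  (volume : Measure (Space d)).toSphere.real Set.univ

/-- The Thomas-Fermi constant `c_TF = 4π²d/(d+2) * (d/|𝕊^{d-1}|)^{2/d}`. -/
def cTF (d : ℕ) : ℝ :=
  4 * Real.pi ^ 2 * d / (d + 2) * (d / sphereArea d) ^ (2 / (d : ℝ))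

end

/-! Write `u = √ρ`. At a constant density `e^y`, the free Fermi gas fills a momentum ball of volume
`e^y / q` for each spin and has the Thomas–Fermi energy. The trial state superposes such gases: at a
point `x` the logarithmic density `y` is random, with a normal law of variance `v` centred at `2 log
u(x) - v/2`. With `profile v y r ^ 2` denoting this law's density in `y` at `u = r`, set
`Ψ_{y,k,σ}(x) = profile v y (u(x)) e^{2πik·x} e_σ` and `γ = ∫ |Ψ⟩⟨Ψ|` over `k` in the Fermi ball of
`y`, over `y` and over `σ`.

Four computations carry the bound. - `γ ≤ 1`: enlarging each ball to all momenta, Plancherel in `k`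
and the normalization of the law in `y` give a Bessel inequality (`lintegral_inner_trialFun_sq_le`).
- `ρ_γ = ρ`: this is the moment `E[e^y] = u²`, exact because of the shift `-v/2`. - The momentum
part of the energy is `q^{-2/d} c_TF E[e^{(1+2/d)y}]`, which exceeds the Thomas–Fermi value only by
a factor `exp((1+2/d)(2/d)v/2)` (`lintegral_exp_mul_profile_sq`). - The gradient part is a Fisher
information, equal to `(1 + 1/v)|∇u|²` wherever `u > 0` (`lintegral_exp_mul_profileDeriv_sq`). The
two parts do not interfere, one being real and the other imaginary relative to the plane wave. The
choice `v = min ε 1` gives the claim.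

Two points need care. Density and energy are defined through `√γ`, which is not explicit; with `γ =
A†A`, where `A g = ⟨Ψ_a, g⟩`, they are read off from Hilbert–Schmidt norms by taking adjoints and
factoring `√γ = VA` with a contraction `V` (`lowestKineticEnergy_le_of_family`). And `u` is only
weakly differentiable, so `profile v y (u(x))` needs a chain rule
(`integral_fderiv_smul_comp_smul`); it applies because a Gaussian in `log r` vanishes faster than
any power of `r` at zero. -/

/-! ### Hilbert–Schmidt norms and factorization of the operator square root. -/

section Hilbert

variable {H K : Type*} [NormedAddCommGroup H] [InnerProductSpace ℂ H] [CompleteSpace H]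
  [NormedAddCommGroup K] [InnerProductSpace ℂ K] [CompleteSpace K]

/-- Parseval's identity in `ℝ≥0∞`. -/
theorem HilbertBasis.tsum_enorm_inner_sq {E ι : Type*} [NormedAddCommGroup E]
    [InnerProductSpace ℂ E] (b : HilbertBasis ι ℂ E) (x : E) :
    ∑' i, ‖inner ℂ (b i) x‖ₑ ^ 2 = ‖x‖ₑ ^ 2 := by
  have h := b.hasSum_inner_mul_inner x x
  have h2 : HasSum (fun i => ‖inner ℂ (b i) x‖ ^ 2) (‖x‖ ^ 2) := by
    have := (Complex.hasSum_iff _ _).1 h |>.1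
    convert this using 1
    · ext i
      rw [← inner_conj_symm x (b i), Complex.conj_mul']
      norm_cast
    · rw [inner_self_eq_norm_sq_to_K]; norm_cast
  have h3 := ENNReal.ofReal_tsum_of_nonneg (fun i => by positivity) h2.summable
  rw [h2.tsum_eq] at h3
  simp only [← ofReal_norm]
  simp only [← ENNReal.ofReal_pow (norm_nonneg _)]
  exact h3.symm

/-- The Hilbert-Schmidt norms of an operator and of its adjoint agree. -/
theorem ContinuousLinearMap.tsum_enorm_sq_adjoint {ι κ : Type*} (b : HilbertBasis ι ℂ H)
    (c : HilbertBasis κ ℂ K) (T : H →L[ℂ] K) :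
    ∑' i, ‖T (b i)‖ₑ ^ 2 = ∑' j, ‖adjoint T (c j)‖ₑ ^ 2 := by
  calc ∑' i, ‖T (b i)‖ₑ ^ 2 = ∑' i, ∑' j, ‖inner ℂ (c j) (T (b i))‖ₑ ^ 2 := by
        simp_rw [c.tsum_enorm_inner_sq]
    _ = ∑' j, ∑' i, ‖inner ℂ (c j) (T (b i))‖ₑ ^ 2 := ENNReal.tsum_comm
    _ = _ := by
        congr 1; ext j
        rw [← b.tsum_enorm_inner_sq]
        congr 1; ext i
        rw [← adjoint_inner_left, ← inner_conj_symm, RCLike.enorm_conj]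

/-- If `‖S u‖ = ‖A u‖` for all `u`, then `S` factors through `A` by a contraction. -/
theorem ContinuousLinearMap.exists_contraction_comp (A : H →L[ℂ] K) (S : H →L[ℂ] H)
    (h : ∀ u, ‖S u‖ = ‖A u‖) : ∃ V : K →L[ℂ] H, ‖V‖ ≤ 1 ∧ V ∘L A = S := by
  set R : Submodule ℂ K := (LinearMap.range (A : H →ₗ[ℂ] K)).topologicalClosure
  have hR : IsClosed (R : Set K) := Submodule.isClosed_topologicalClosure _
  have : CompleteSpace R := hR.completeSpace_coe
  have hmem : ∀ u, A u ∈ R := fun u => Submodule.le_topologicalClosure _ ⟨u, rfl⟩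
  set A' : H →ₗ[ℂ] R := (A : H →ₗ[ℂ] K).codRestrict R hmem
  have hd : DenseRange A' := by
    intro x
    rw [Metric.mem_closure_iff]
    intro e he
    obtain ⟨y, ⟨u, rfl⟩, hu⟩ := Metric.mem_closure_iff.1 x.2 e he
    exact ⟨A' u, ⟨u, rfl⟩, hu⟩
  have hb : ∀ u, ‖(S : H →ₗ[ℂ] H) u‖ ≤ 1 * ‖A' u‖ := fun u => by
    rw [one_mul]; exact (h u).le
  -- `A u ↦ S u` is well defined and isometric on the range of `A`. It extends to the closure by
  -- density, and to all of `K` by precomposing with the orthogonal projection.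
  set W := (S : H →ₗ[ℂ] H).extendOfNorm A'
  have hW : ‖W‖ ≤ 1 := LinearMap.opNorm_extendOfNorm_le hd zero_le_one hb
  refine ⟨W ∘L R.orthogonalProjectionOnto, ?_, ?_⟩
  · calc _ ≤ ‖W‖ * ‖R.orthogonalProjectionOnto‖ := opNorm_comp_le _ _
      _ ≤ 1 * 1 := by
        gcongr
        exact Submodule.orthogonalProjectionOnto_norm_le _
      _ = 1 := one_mul 1
  · ext u
    have : R.orthogonalProjectionOnto (A u) = A' u :=
      Submodule.orthogonalProjectionOnto_mem_subspace_eq_self (A' u)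
    rw [comp_apply, comp_apply, this]
    exact LinearMap.extendOfNorm_eq hd ⟨1, hb⟩ u

theorem opSqrt_adjoint (γ : H →L[ℂ] H) : ContinuousLinearMap.adjoint (opSqrt γ) = opSqrt γ := by
  have h := (CFC.sqrt_nonneg γ)
  rw [ContinuousLinearMap.nonneg_iff_isPositive] at h
  exact h.isSelfAdjoint.star_eq

/-- Both squared norms equal `⟨u, A†A u⟩`. This is all that is ever used about the square root of
the trial state, besides its self-adjointness. -/
theorem norm_opSqrt_adjoint_comp_self (A : H →L[ℂ] K) (u : H) :
    ‖opSqrt (ContinuousLinearMap.adjoint A ∘L A) u‖ = ‖A u‖ := by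
  set γ := ContinuousLinearMap.adjoint A ∘L A
  have hγ : 0 ≤ γ := by
    rw [ContinuousLinearMap.nonneg_iff_isPositive]
    exact ContinuousLinearMap.isPositive_adjoint_comp_self A
  have hs : opSqrt γ * opSqrt γ = γ := CFC.sqrt_mul_sqrt_self γ hγ
  have : inner ℂ (opSqrt γ u) (opSqrt γ u) = inner ℂ (A u) (A u) := by
    rw [← ContinuousLinearMap.adjoint_inner_right, opSqrt_adjoint,
      ← ContinuousLinearMap.adjoint_inner_right]
    exact congrArg (fun T : H →L[ℂ] H => inner ℂ u (T u)) hs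
  rw [inner_self_eq_norm_sq_to_K, inner_self_eq_norm_sq_to_K] at this
  have h2 : ‖opSqrt γ u‖ ^ 2 = ‖A u‖ ^ 2 := by exact_mod_cast this
  exact (sq_eq_sq₀ (norm_nonneg _) (norm_nonneg _)).1 h2

theorem adjoint_comp_self_nonneg (A : H →L[ℂ] K) : 0 ≤ ContinuousLinearMap.adjoint A ∘L A := by
  rw [ContinuousLinearMap.nonneg_iff_isPositive]
  exact ContinuousLinearMap.isPositive_adjoint_comp_self A

theorem adjoint_comp_self_le_one (A : H →L[ℂ] K) (hA : ∀ u, ‖A u‖ ≤ ‖u‖) :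
    ContinuousLinearMap.adjoint A ∘L A ≤ 1 := by
  rw [ContinuousLinearMap.le_def, ContinuousLinearMap.isPositive_def']
  refine ⟨(IsSelfAdjoint.one _).sub
    (ContinuousLinearMap.isPositive_adjoint_comp_self A).isSelfAdjoint, fun u => ?_⟩
  rw [ContinuousLinearMap.reApplyInnerSelf_apply, sub_apply, inner_sub_left,
    ContinuousLinearMap.comp_apply, ContinuousLinearMap.adjoint_inner_left,
    one_apply_eq_self, inner_self_eq_norm_sq_to_K, inner_self_eq_norm_sq_to_K]
  have := pow_le_pow_left₀ (norm_nonneg _) (hA u) 2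
  norm_cast
  simpa using this

end Hilbert

/-! ### Analysis operators of square-integrable families of vectors. -/

section Analysis

variable {Ω : Type*} [MeasurableSpace Ω] {μ : Measure Ω}

theorem MeasureTheory.Lp.enorm_sq_eq_lintegral {α E : Type*} [MeasurableSpace α]
    [NormedAddCommGroup E] {ν : Measure α} (f : Lp E 2 ν) :
    ‖f‖ₑ ^ 2 = ∫⁻ x, ‖f x‖ₑ ^ 2 ∂ν := by
  rw [Lp.enorm_def, eLpNorm_eq_lintegral_rpow_enorm_toReal (by simp) (by simp)]
  simp only [ENNReal.toReal_ofNat, ENNReal.rpow_ofNat, one_div]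
  rw [← ENNReal.rpow_natCast, ← ENNReal.rpow_mul]
  simp

theorem memLp_two_of_lintegral_lt_top {α E : Type*} [MeasurableSpace α]
    [NormedAddCommGroup E] {ν : Measure α} {f : α → E} (hf : AEStronglyMeasurable f ν)
    (h : ∫⁻ x, ‖f x‖ₑ ^ 2 ∂ν < ⊤) : MemLp f 2 ν := by
  refine ⟨hf, ?_⟩
  rw [eLpNorm_lt_top_iff_lintegral_rpow_enorm_lt_top (by simp) (by simp)]
  simpa using h

variable {H : Type*} [NormedAddCommGroup H] [InnerProductSpace ℂ H]

/-- A weakly measurable family `Ψ` with `∫ ‖Ψ a‖² < ⊤` has a bounded analysis operator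
`u ↦ ⟨Ψ a, u⟩`. -/
theorem exists_analysisOperator (Ψ : Ω → H)
    (hm : ∀ u, AEStronglyMeasurable (fun a => inner ℂ (Ψ a) u) μ)
    (hfin : ∫⁻ a, ‖Ψ a‖ₑ ^ 2 ∂μ < ⊤) :
    ∃ A : H →L[ℂ] Lp ℂ 2 μ, ∀ u, A u =ᵐ[μ] fun a => inner ℂ (Ψ a) u := by
  -- Cauchy–Schwarz at each `a`. The resulting operator norm bound is crude and serves only for
  -- continuity; the sharp bound by one comes from a Bessel inequality.
  have hbd : ∀ u, ∫⁻ a, ‖inner ℂ (Ψ a) u‖ₑ ^ 2 ∂μ ≤ (∫⁻ a, ‖Ψ a‖ₑ ^ 2 ∂μ) * ‖u‖ₑ ^ 2 := by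
    intro u
    rw [← lintegral_mul_const' _ _ (by finiteness)]
    refine lintegral_mono fun a => ?_
    rw [← mul_pow]
    gcongr
    simp only [← ofReal_norm]
    rw [← ENNReal.ofReal_mul (norm_nonneg _)]
    exact ENNReal.ofReal_le_ofReal (norm_inner_le_norm _ _)
  have hmem : ∀ u, MemLp (fun a => inner ℂ (Ψ a) u) 2 μ := fun u =>
    memLp_two_of_lintegral_lt_top (hm u)
      ((hbd u).trans_lt (ENNReal.mul_lt_top hfin (by finiteness)))
  let A₀ : H →ₗ[ℂ] Lp ℂ 2 μ :=
    { toFun := fun u => (hmem u).toLp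
      map_add' := fun u v => by
        rw [← MemLp.toLp_add]
        congr 1
        ext a; exact inner_add_right _ _ _
      map_smul' := fun c u => by
        rw [RingHom.id_apply, ← MemLp.toLp_const_smul]
        congr 1
        ext a; exact inner_smul_right _ _ _ }
  set C := ∫⁻ a, ‖Ψ a‖ₑ ^ 2 ∂μ
  refine ⟨A₀.mkContinuous (Real.sqrt C.toReal) fun u => ?_, fun u => (hmem u).coeFn_toLp⟩
  have h1 : ‖A₀ u‖ₑ ^ 2 ≤ C * ‖u‖ₑ ^ 2 := by
    rw [Lp.enorm_sq_eq_lintegral]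
    refine le_trans (le_of_eq (lintegral_congr_ae ?_)) (hbd u)
    filter_upwards [(hmem u).coeFn_toLp] with a ha
    show ‖(hmem u).toLp _ a‖ₑ ^ 2 = _
    rw [ha]
  have h2 := ENNReal.toReal_mono (ENNReal.mul_ne_top hfin.ne (by finiteness)) h1
  rw [ENNReal.toReal_mul, ENNReal.toReal_pow, ENNReal.toReal_pow, toReal_enorm, toReal_enorm] at h2
  refine abs_le_of_sq_le_sq' ?_ (by positivity) |>.2
  rw [mul_pow, Real.sq_sqrt ENNReal.toReal_nonneg]
  exact h2

/-- The Hilbert-Schmidt norm of the analysis operator. -/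
theorem tsum_enorm_analysisOperator {ι : Type*} [Countable ι] (b : HilbertBasis ι ℂ H) (Ψ : Ω → H)
    (hm : ∀ u, AEStronglyMeasurable (fun a => inner ℂ (Ψ a) u) μ)
    (A : H →L[ℂ] Lp ℂ 2 μ) (hA : ∀ u, A u =ᵐ[μ] fun a => inner ℂ (Ψ a) u) :
    ∑' i, ‖A (b i)‖ₑ ^ 2 = ∫⁻ a, ‖Ψ a‖ₑ ^ 2 ∂μ := by
  have : ∀ i, ‖A (b i)‖ₑ ^ 2 = ∫⁻ a, ‖inner ℂ (b i) (Ψ a)‖ₑ ^ 2 ∂μ := fun i => by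
    rw [Lp.enorm_sq_eq_lintegral]
    refine lintegral_congr_ae ?_
    filter_upwards [hA (b i)] with a ha
    rw [ha, ← inner_conj_symm, RCLike.enorm_conj]
  simp_rw [this]
  rw [← lintegral_tsum]
  · simp_rw [b.tsum_enorm_inner_sq]
  · intro i
    have := (hm (b i)).enorm.pow_const 2
    refine this.congr (Filter.Eventually.of_forall fun a => ?_)
    simp only
    rw [← inner_conj_symm, RCLike.enorm_conj]

end Analysis

/-! ### Density and kinetic energy of a trial state given by a family of vectors. -/

section TrialState

variable {d q : ℕ}

/-- Distinct basis vectors lie at distance `√2`, so balls of radius `1/2` around them are disjoint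
open sets. Countability is what allows sums over the basis to be exchanged with integrals. -/
theorem countable_of_hilbertBasis {ι H : Type*} [NormedAddCommGroup H] [InnerProductSpace ℂ H]
    [TopologicalSpace.SeparableSpace H] (b : HilbertBasis ι ℂ H) : Countable ι := by
  have h : Set.PairwiseDisjoint (Set.univ : Set ι) (fun i => Metric.ball (b i) (1 / 2 : ℝ)) := by
    intro i _ j _ hij
    refine Metric.ball_disjoint_ball ?_
    have h1 : ‖b i - b j‖ ^ 2 = 2 := by
      rw [@norm_sub_sq ℂ, b.orthonormal.1 i, b.orthonormal.1 j, b.orthonormal.2 hij]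
      norm_num
    rw [dist_eq_norm]
    nlinarith [norm_nonneg (b i - b j)]
  have := h.countable_of_isOpen (fun i _ => Metric.isOpen_ball)
    (fun i _ => ⟨b i, Metric.mem_ball_self (by norm_num)⟩)
  exact Set.countable_univ_iff.1 this

theorem separableSpace_oneParticle : TopologicalSpace.SeparableSpace (OneParticle d q) := by
  have : Fact ((2 : ℝ≥0∞) ≠ ⊤) := ⟨by simp⟩
  infer_instance

/-- Multiplication by the indicator function of a measurable set on `L²`. -/
theorem exists_indicatorOperator {s : Set (Space d)} (hs : MeasurableSet s) :
    ∃ P : OneParticle d q →L[ℂ] OneParticle d q, ∀ u, ‖P u‖ₑ ^ 2 = ∫⁻ x in s, ‖u x‖ₑ ^ 2 := by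
  have hm : ∀ u : OneParticle d q, MemLp (s.indicator u) 2 volume := fun u =>
    (Lp.memLp u).indicator hs
  let P₀ : OneParticle d q →ₗ[ℂ] OneParticle d q :=
    { toFun := fun u => (hm u).toLp
      map_add' := fun u v => by
        rw [← MemLp.toLp_add]
        refine MemLp.toLp_congr _ _ ?_
        filter_upwards [Lp.coeFn_add u v] with x hx
        by_cases h : x ∈ s
        · simpa only [Pi.add_apply, Set.indicator_of_mem h] using hx
        · simp [h]
      map_smul' := fun c u => by
        rw [RingHom.id_apply, ← MemLp.toLp_const_smul]
        refine MemLp.toLp_congr _ _ ?_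
        filter_upwards [Lp.coeFn_smul c u] with x hx
        by_cases h : x ∈ s
        · simpa only [Pi.smul_apply, Set.indicator_of_mem h] using hx
        · simp [h] }
  have key : ∀ u, ‖P₀ u‖ₑ ^ 2 = ∫⁻ x in s, ‖u x‖ₑ ^ 2 := fun u => by
    rw [Lp.enorm_sq_eq_lintegral, ← lintegral_indicator hs]
    refine lintegral_congr_ae ?_
    filter_upwards [(hm u).coeFn_toLp] with x hx
    show ‖(hm u).toLp _ x‖ₑ ^ 2 = _
    rw [hx]
    by_cases h : x ∈ s <;> simp [h]
  refine ⟨P₀.mkContinuous 1 fun u => ?_, key⟩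
  have h1 : ‖P₀ u‖ₑ ^ 2 ≤ ‖u‖ₑ ^ 2 := by
    rw [key, Lp.enorm_sq_eq_lintegral]
    exact setLIntegral_le_lintegral _ _
  have h2 := ENNReal.toReal_mono (by finiteness) h1
  rw [ENNReal.toReal_pow, ENNReal.toReal_pow, toReal_enorm, toReal_enorm] at h2
  rw [one_mul]
  exact (abs_le_of_sq_le_sq' h2 (norm_nonneg _)).2

theorem memLp_smul_const {χ : Space d → ℝ} (hc : Continuous χ) (hs : HasCompactSupport χ)
    (c : EuclideanSpace ℂ (Fin q)) : MemLp (fun x => χ x • c) 2 volume :=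
  (hc.smul continuous_const).memLp_of_hasCompactSupport hs.smul_right

theorem integrable_smul_coeFn {χ : Space d → ℝ} (hc : Continuous χ) (hs : HasCompactSupport χ)
    (u : OneParticle d q) : Integrable (fun x => χ x • u x) volume :=
  ((Lp.memLp u).locallyIntegrable (by norm_num)).integrable_smul_left_of_hasCompactSupport hc hs

/-- This turns the vector-valued integrals in the definition of a weak derivative into `L²` inner
products, across which adjoints can be moved. -/
theorem inner_smul_const_toLp {χ : Space d → ℝ} (hc : Continuous χ) (hs : HasCompactSupport χ)
    (c : EuclideanSpace ℂ (Fin q)) (u : OneParticle d q) :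
    inner ℂ (memLp_smul_const hc hs c).toLp u = inner ℂ c (∫ x, χ x • u x) := by
  rw [L2.inner_def, ← integral_inner (integrable_smul_coeFn hc hs u)]
  refine integral_congr_ae ?_
  filter_upwards [(memLp_smul_const hc hs c).coeFn_toLp] with x hx
  rw [hx, ← Complex.coe_smul, ← Complex.coe_smul, inner_smul_left, inner_smul_right]
  simp

theorem continuous_fderiv_apply_single {φ : Space d → ℝ} (h : ContDiff ℝ ∞ φ) (j : Fin d) :
    Continuous (fun x => fderiv ℝ φ x (EuclideanSpace.single j 1)) :=
  (h.continuous_fderiv (by simp)).clm_apply continuous_const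

theorem hasCompactSupport_fderiv_apply_single {φ : Space d → ℝ} (h : HasCompactSupport φ)
    (j : Fin d) :
    HasCompactSupport (fun x => fderiv ℝ φ x (EuclideanSpace.single j 1)) :=
  h.fderiv_apply ℝ _

variable {Ω : Type*} [MeasurableSpace Ω] {μ : Measure Ω}

/-- Synthesis operators of a family and of its weak derivatives: `∂_j (A† g) = (A_j)† g`. -/
theorem hasWeakPartialDeriv_adjoint {j : Fin d} {Ψ Ψ' : Ω → OneParticle d q}
    (hder : ∀ a, HasWeakPartialDeriv j (Ψ a) (Ψ' a))
    {A A' : OneParticle d q →L[ℂ] Lp ℂ 2 μ}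
    (hA : ∀ u, A u =ᵐ[μ] fun a => inner ℂ (Ψ a) u)
    (hA' : ∀ u, A' u =ᵐ[μ] fun a => inner ℂ (Ψ' a) u) (g : Lp ℂ 2 μ) :
    HasWeakPartialDeriv j (ContinuousLinearMap.adjoint A g : OneParticle d q)
      (ContinuousLinearMap.adjoint A' g : OneParticle d q) := by
  refine ⟨(Lp.memLp _).locallyIntegrable (by norm_num),
    (Lp.memLp _).locallyIntegrable (by norm_num), fun φ hφ hs => ?_⟩
  have hc' := continuous_fderiv_apply_single hφ j
  have hs' := hasCompactSupport_fderiv_apply_single hs j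
  refine ext_inner_left ℂ fun c => ?_
  rw [inner_neg_right, ← inner_smul_const_toLp hc' hs', ← inner_smul_const_toLp hφ.continuous hs,
    ContinuousLinearMap.adjoint_inner_right, ContinuousLinearMap.adjoint_inner_right,
    ← inner_neg_left]
  congr 1
  -- What remains is `A (∂_jφ c) = -A' (φ c)`, which holds at each parameter `a` as the weak
  -- derivative of `Ψ a` tested against `φ`.
  refine Lp.ext ?_
  filter_upwards [hA (memLp_smul_const hc' hs' c).toLp,
    hA' (memLp_smul_const hφ.continuous hs c).toLp,
    Lp.coeFn_neg (A' (memLp_smul_const hφ.continuous hs c).toLp)] with a h1 h2 h3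
  rw [h1, h3, Pi.neg_apply, h2, ← inner_conj_symm, inner_smul_const_toLp hc' hs',
    (hder a).integral_eq φ hφ hs, inner_neg_right, ← inner_smul_const_toLp hφ.continuous hs,
    map_neg, inner_conj_symm]

/-- Upper bound on the lowest kinetic energy by the trial state
`γ = ∫ |Ψ_a⟩⟨Ψ_a| dμ(a)`. -/
theorem lowestKineticEnergy_le_of_family {ρ : Space d → ℝ} (hρ : AEMeasurable ρ)
    (Ψ : Ω → OneParticle d q) (Ψ' : Fin d → Ω → OneParticle d q)
    (hm : ∀ u, AEStronglyMeasurable (fun a => inner ℂ (Ψ a) u) μ)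
    (hm' : ∀ j u, AEStronglyMeasurable (fun a => inner ℂ (Ψ' j a) u) μ)
    (hfin : ∫⁻ a, ‖Ψ a‖ₑ ^ 2 ∂μ < ⊤) (hfin' : ∀ j, ∫⁻ a, ‖Ψ' j a‖ₑ ^ 2 ∂μ < ⊤)
    (hder : ∀ j a, HasWeakPartialDeriv j (Ψ a) (Ψ' j a))
    (hbessel : ∀ u, ∫⁻ a, ‖inner ℂ (Ψ a) u‖ₑ ^ 2 ∂μ ≤ ‖u‖ₑ ^ 2)
    (hdens : ∀ s : Set (Space d), MeasurableSet s →
      ∫⁻ a, (∫⁻ x in s, ‖Ψ a x‖ₑ ^ 2) ∂μ = ∫⁻ x in s, ENNReal.ofReal (ρ x)) :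
    lowestKineticEnergy q ρ ≤ ∑ j, ∫⁻ a, ‖Ψ' j a‖ₑ ^ 2 ∂μ := by
  set b := oneParticleBasis d q with hb
  have := separableSpace_oneParticle (d := d) (q := q)
  have hcount := countable_of_hilbertBasis b
  obtain ⟨A, hA⟩ := exists_analysisOperator Ψ hm hfin
  choose A' hA' using fun j => exists_analysisOperator (Ψ' j) (hm' j) (hfin' j)
  set γ := ContinuousLinearMap.adjoint A ∘L A with hγ
  have hnorm : ∀ u, ‖A u‖ ≤ ‖u‖ := fun u => by
    have h1 : ‖A u‖ₑ ^ 2 ≤ ‖u‖ₑ ^ 2 := by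
      rw [Lp.enorm_sq_eq_lintegral]
      refine le_trans (le_of_eq (lintegral_congr_ae ?_)) (hbessel u)
      filter_upwards [hA u] with a ha
      rw [ha]
    have h2 := ENNReal.toReal_mono (by finiteness) h1
    rw [ENNReal.toReal_pow, ENNReal.toReal_pow, toReal_enorm, toReal_enorm] at h2
    exact (abs_le_of_sq_le_sq' h2 (norm_nonneg _)).2
  have hsq : ∀ u, ‖opSqrt γ u‖ = ‖A u‖ := norm_opSqrt_adjoint_comp_self A
  have hsqe : ∀ u, ‖opSqrt γ u‖ₑ = ‖A u‖ₑ := fun u => by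
    rw [← ofReal_norm, hsq, ofReal_norm]
  obtain ⟨V, hV, hVA⟩ := ContinuousLinearMap.exists_contraction_comp A (opSqrt γ) hsq
  have hdensity : density γ =ᵐ[volume] fun x => ENNReal.ofReal (ρ x) := by
    have hmeas : ∀ i, AEMeasurable (fun x => ‖(opSqrt γ (b i) : OneParticle d q) x‖ₑ ^ 2) volume :=
      fun i => ((Lp.aestronglyMeasurable _).enorm).pow_const 2
    refine ae_eq_of_forall_setLIntegral_eq_of_sigmaFinite₀ (AEMeasurable.tsum hmeas)
      hρ.ennreal_ofReal fun s hs _ => ?_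
    rw [← hdens s hs]
    obtain ⟨P, hP⟩ := exists_indicatorOperator (d := d) (q := q) hs
    -- `P √γ` has the same Hilbert–Schmidt norm as its adjoint `√γ P†`, and the latter depends on
    -- `√γ` only through `‖√γ u‖ = ‖A u‖`. So `√γ` can be replaced by `A`, the analysis operator of
    -- `Ψ`, and `A P†` is that of `P Ψ`.
    calc ∫⁻ x in s, density γ x
        = ∑' i, ∫⁻ x in s, ‖(opSqrt γ (b i) : OneParticle d q) x‖ₑ ^ 2 :=
          lintegral_tsum fun i => (hmeas i).restrict
      _ = ∑' i, ‖(P ∘L opSqrt γ) (b i)‖ₑ ^ 2 := by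
          simp_rw [ContinuousLinearMap.comp_apply, hP]
      _ = ∑' i, ‖(A ∘L ContinuousLinearMap.adjoint P) (b i)‖ₑ ^ 2 := by
          rw [ContinuousLinearMap.tsum_enorm_sq_adjoint b b, ContinuousLinearMap.adjoint_comp,
            opSqrt_adjoint]
          simp_rw [ContinuousLinearMap.comp_apply, hsqe]
      _ = ∫⁻ a, ‖P (Ψ a)‖ₑ ^ 2 ∂μ := by
          refine tsum_enorm_analysisOperator b (fun a => P (Ψ a)) (fun u => ?_) _ fun u => ?_
          · simp_rw [← ContinuousLinearMap.adjoint_inner_right]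
            exact hm _
          · simp_rw [← ContinuousLinearMap.adjoint_inner_right]
            exact hA _
      _ = _ := by simp_rw [hP]
  refine (iInf₂_le_of_le γ (adjoint_comp_self_nonneg A)
    (iInf₂_le_of_le (adjoint_comp_self_le_one A hnorm) hdensity le_rfl)).trans ?_
  -- In this form the weak derivative of `√γ e_i` is obtained by replacing `A†` with the adjoint of
  -- the analysis operator of `Ψ' j`.
  have hS : opSqrt γ = ContinuousLinearMap.adjoint A ∘L ContinuousLinearMap.adjoint V := by
    rw [← ContinuousLinearMap.adjoint_comp, hVA, opSqrt_adjoint]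
  have hdir : ∀ i, dirichletEnergy (opSqrt γ (b i) : OneParticle d q) ≤
      ∑ j, ‖(ContinuousLinearMap.adjoint (A' j) ∘L ContinuousLinearMap.adjoint V) (b i)‖ₑ ^ 2 := by
    intro i
    have hw : ∀ j, HasWeakPartialDeriv j (opSqrt γ (b i) : OneParticle d q)
        ((ContinuousLinearMap.adjoint (A' j) (ContinuousLinearMap.adjoint V (b i)) :
          OneParticle d q)) := fun j => by
      rw [hS]
      exact hasWeakPartialDeriv_adjoint (hder j) hA (hA' j) _
    refine (iInf₂_le _ hw).trans (le_of_eq ?_)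
    refine Finset.sum_congr rfl fun j _ => ?_
    rw [← Lp.enorm_sq_eq_lintegral]; rfl
  calc kineticEnergy γ
      ≤ ∑' i, ∑ j, ‖(ContinuousLinearMap.adjoint (A' j) ∘L
          ContinuousLinearMap.adjoint V) (b i)‖ₑ ^ 2 := ENNReal.tsum_le_tsum hdir
    _ = ∑ j, ∑' i, ‖(ContinuousLinearMap.adjoint (A' j) ∘L
          ContinuousLinearMap.adjoint V) (b i)‖ₑ ^ 2 :=
        Summable.tsum_finsetSum fun _ _ => ENNReal.summable
    _ ≤ _ := by
        -- Taking adjoints, the Hilbert–Schmidt norm is that of `V ∘ A' j`, and the contraction `V`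
        -- can be dropped.
        refine Finset.sum_le_sum fun j _ => ?_
        rw [ContinuousLinearMap.tsum_enorm_sq_adjoint b b, ContinuousLinearMap.adjoint_comp,
          ContinuousLinearMap.adjoint_adjoint, ContinuousLinearMap.adjoint_adjoint,
          ← tsum_enorm_analysisOperator b (Ψ' j) (hm' j) (A' j) (hA' j)]
        refine ENNReal.tsum_le_tsum fun i => ?_
        gcongr
        rw [ContinuousLinearMap.comp_apply, ← ofReal_norm, ← ofReal_norm]
        refine ENNReal.ofReal_le_ofReal ((V.le_opNorm _).trans ?_)
        exact mul_le_of_le_one_left (norm_nonneg _) hV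

end TrialState

/-! ### Plancherel for the Fourier integral. -/

section Plancherel

open FourierTransform SchwartzMap

/-- Plancherel's identity for the Fourier integral of a function in `L¹ ∩ L²`. -/
theorem lintegral_enorm_fourier_sq {d : ℕ} {f : Space d → ℂ} (h1 : Integrable f)
    (h2 : MemLp f 2 volume) : ∫⁻ k, ‖𝓕 f k‖ₑ ^ 2 = ∫⁻ x, ‖f x‖ₑ ^ 2 := by
  set F : Lp ℂ 2 (volume : Measure (Space d)) := h2.toLp
  have hcont : Continuous (𝓕 f) :=
    VectorFourier.fourierIntegral_continuous Real.continuous_fourierChar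
      (by exact continuous_inner) h1
  -- The `L²` transform and the Fourier integral are identified by testing against smooth compactly
  -- supported functions: for both, the transform can be moved onto the test function.
  have hae : ∀ᵐ k, (𝓕 F : Lp ℂ 2 (volume : Measure (Space d))) k = 𝓕 f k := by
    refine ae_eq_of_integral_contDiff_smul_eq ((Lp.memLp _).locallyIntegrable (by norm_num))
      hcont.locallyIntegrable fun g hg hs => ?_
    have hs' : HasCompactSupport (Complex.ofRealCLM ∘ g) := hs.comp_left rfl
    set φ : 𝓢(Space d, ℂ) :=
      hs'.toSchwartzMap (Complex.ofRealCLM.contDiff.comp hg) with hφ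
    have hφg : ∀ x, φ x = (g x : ℂ) := fun x => rfl
    have e1 := congrArg (fun T : 𝓢'(Space d, ℂ) => T φ) (Lp.fourier_toTemperedDistribution_eq F)
    simp only [TemperedDistribution.fourier_apply, Lp.toTemperedDistribution_apply] at e1
    have e2 := VectorFourier.integral_fourierIntegral_smul_eq_flip (L := innerₗ (Space d))
      (μ := (volume : Measure (Space d))) (ν := (volume : Measure (Space d)))
      Real.continuous_fourierChar continuous_inner φ.integrable h1
    rw [flip_innerₗ] at e2
    calc ∫ x, g x • (𝓕 F : Lp ℂ 2 (volume : Measure (Space d))) x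
        = ∫ x, φ x • (𝓕 F : Lp ℂ 2 (volume : Measure (Space d))) x := by
          simp_rw [hφg, Complex.coe_smul]
      _ = ∫ x, (𝓕 φ) x • F x := e1.symm
      _ = ∫ x, (𝓕 φ) x • f x := by
          refine integral_congr_ae ?_
          filter_upwards [h2.coeFn_toLp] with x hx
          rw [hx]
      _ = ∫ x, φ x • 𝓕 f x := by
          rw [SchwartzMap.fourier_coe]; exact e2
      _ = _ := by simp_rw [hφg, Complex.coe_smul]
  calc ∫⁻ k, ‖𝓕 f k‖ₑ ^ 2
      = ∫⁻ k, ‖(𝓕 F : Lp ℂ 2 (volume : Measure (Space d))) k‖ₑ ^ 2 := by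
        refine lintegral_congr_ae ?_
        filter_upwards [hae] with k hk
        rw [hk]
    _ = ‖F‖ₑ ^ 2 := by
        rw [← Lp.enorm_sq_eq_lintegral, ← ofReal_norm, Lp.norm_fourier_eq, ofReal_norm]
    _ = _ := by
        rw [Lp.enorm_sq_eq_lintegral]
        refine lintegral_congr_ae ?_
        filter_upwards [h2.coeFn_toLp] with x hx
        rw [hx]

end Plancherel

/-! ### Mollification and the chain rule for weak derivatives. -/

section ChainRule

open Filter Topology Convolution

variable {d : ℕ}

/-- Scheffé's lemma. -/
theorem tendsto_integral_abs_sub_of_integral_eq {α : Type*} [MeasurableSpace α] {ν : Measure α}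
    {f : α → ℝ} {F : ℕ → α → ℝ} (hf : Integrable f ν) (hF : ∀ n, Integrable (F n) ν)
    (hf0 : ∀ x, 0 ≤ f x) (hF0 : ∀ n x, 0 ≤ F n x) (hint : ∀ n, ∫ x, F n x ∂ν = ∫ x, f x ∂ν)
    (hlim : ∀ᵐ x ∂ν, Tendsto (fun n => F n x) atTop (𝓝 (f x))) :
    Tendsto (fun n => ∫ x, |F n x - f x| ∂ν) atTop (𝓝 0) := by
  -- `|F n - f| = (F n - f) + 2 (f - F n)₊`: the first term has integral zero, and the second is
  -- dominated by `f` because `F n ≥ 0`.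
  have hpos : ∀ n, Integrable (fun x => max (f x - F n x) 0) ν := fun n => (hf.sub (hF n)).pos_part
  have h1 : ∀ n, ∫ x, |F n x - f x| ∂ν = 2 * ∫ x, max (f x - F n x) 0 ∂ν := fun n => by
    have : ∀ x, |F n x - f x| = (F n x - f x) + 2 * max (f x - F n x) 0 := fun x => by
      rcases le_total (f x) (F n x) with h | h
      · rw [abs_of_nonneg (by linarith), max_eq_right (by linarith)]; ring
      · rw [abs_of_nonpos (by linarith), max_eq_left (by linarith)]; ring
    simp_rw [this]
    have hsub : Integrable (fun x => F n x - f x) ν := (hF n).sub hf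
    rw [integral_add hsub ((hpos n).const_mul 2), integral_sub (hF n) hf, hint,
      integral_const_mul]
    ring
  simp_rw [h1]
  have h2 : Tendsto (fun n => ∫ x, max (f x - F n x) 0 ∂ν) atTop (𝓝 (∫ _, (0 : ℝ) ∂ν)) := by
    refine tendsto_integral_of_dominated_convergence f (fun n => (hpos n).aestronglyMeasurable) hf
      (fun n => Eventually.of_forall fun x => ?_) ?_
    · rw [Real.norm_of_nonneg (le_max_right _ _)]
      exact max_le (by linarith [hF0 n x]) (hf0 x)
    · filter_upwards [hlim] with x hx
      have := ((tendsto_const_nhds (x := f x)).sub hx).max (tendsto_const_nhds (x := (0 : ℝ)))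
      simpa using this
  simpa using h2.const_mul 2

/-- A sequence of bump functions shrinking to the origin. -/
noncomputable def shrinkingBump (d n : ℕ) : ContDiffBump (0 : Space d) where
  rIn := 1 / (n + 2)
  rOut := 2 / (n + 2)
  rIn_pos := by positivity
  rIn_lt_rOut := by
    have : (0 : ℝ) < n + 2 := by positivity
    gcongr
    norm_num

theorem shrinkingBump_rOut_le (d n : ℕ) : (shrinkingBump d n).rOut ≤ 1 := by
  show (2 : ℝ) / (n + 2) ≤ 1
  rw [div_le_one (by positivity)]
  have : (0 : ℝ) ≤ n := n.cast_nonneg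
  linarith

/-- The mollification of a real function. -/
noncomputable def mollify (n : ℕ) (f : Space d → ℝ) : Space d → ℝ :=
  (shrinkingBump d n).normed volume ⋆[ContinuousLinearMap.lsmul ℝ ℝ, volume] f

theorem mollify_apply (n : ℕ) (f : Space d → ℝ) (x : Space d) :
    mollify n f x = ∫ t, (shrinkingBump d n).normed volume t * f (x - t) := rfl

theorem mollify_apply_swap (n : ℕ) (f : Space d → ℝ) (x : Space d) :
    mollify n f x = ∫ t, (shrinkingBump d n).normed volume (x - t) * f t := by
  rw [mollify, convolution_eq_swap]; rfl

theorem ae_tendsto_mollify {f : Space d → ℝ} (hf : LocallyIntegrable f volume) :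
    ∀ᵐ x, Tendsto (fun n => mollify n f x) atTop (𝓝 (f x)) := by
  -- `K = 2` is the fixed ratio of the outer to the inner radius of the bumps.
  refine ContDiffBump.ae_convolution_tendsto_right_of_locallyIntegrable (K := 2)
    (φ := shrinkingBump d) ?_ (Eventually.of_forall fun n => ?_) hf
  · have h : Tendsto (fun n : ℕ => (2 : ℝ) / ((n : ℝ) + 2)) atTop (𝓝 0) :=
      tendsto_const_nhds.div_atTop
        (tendsto_atTop_add_const_right _ _ tendsto_natCast_atTop_atTop)
    exact h
  · show (2 : ℝ) / (n + 2) ≤ 2 * (1 / (n + 2))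
    rw [mul_one_div]

theorem contDiff_mollify (n : ℕ) {f : Space d → ℝ} (hf : LocallyIntegrable f volume) :
    ContDiff ℝ ∞ (mollify n f) :=
  (shrinkingBump d n).hasCompactSupport_normed.contDiff_convolution_left _
    (shrinkingBump d n).contDiff_normed hf

theorem integrable_mollify (n : ℕ) {f : Space d → ℝ} (hf : Integrable f) :
    Integrable (mollify n f) :=
  (shrinkingBump d n).integrable_normed.integrable_convolution _ hf

theorem integral_mollify (n : ℕ) {f : Space d → ℝ} (hf : Integrable f) :
    ∫ x, mollify n f x = ∫ x, f x := by
  have := integral_convolution (ContinuousLinearMap.lsmul ℝ ℝ)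
    (shrinkingBump d n).integrable_normed (μ := volume) (ν := volume) hf
  rw [mollify, this, (shrinkingBump d n).integral_normed]
  simp

theorem mollify_sub (n : ℕ) {f g : Space d → ℝ} (hf : LocallyIntegrable f volume)
    (hg : LocallyIntegrable g volume) (x : Space d) :
    mollify n (fun y => f y - g y) x = mollify n f x - mollify n g x := by
  have hc : ∀ {f : Space d → ℝ}, LocallyIntegrable f volume →
      Integrable (fun t => (shrinkingBump d n).normed volume (x - t) * f t) volume := fun hf =>
    hf.integrable_smul_left_of_hasCompactSupport
      ((shrinkingBump d n).continuous_normed.comp (continuous_const.sub continuous_id))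
      ((shrinkingBump d n).hasCompactSupport_normed.comp_homeomorph (Homeomorph.subLeft x))
  simp_rw [mollify_apply_swap]
  rw [← integral_sub (hc hf) (hc hg)]
  simp_rw [mul_sub]

/-- Mollification preserves positivity and integrals and converges almost everywhere, so Scheffé's
lemma applies to the positive and negative parts separately. -/
theorem tendsto_integral_abs_mollify_sub {f : Space d → ℝ} (hf : Integrable f) :
    Tendsto (fun n => ∫ x, |mollify n f x - f x|) atTop (𝓝 0) := by
  have key : ∀ {f : Space d → ℝ}, Integrable f → (∀ x, 0 ≤ f x) →
      Tendsto (fun n => ∫ x, |mollify n f x - f x|) atTop (𝓝 0) := fun hf h0 =>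
    tendsto_integral_abs_sub_of_integral_eq hf (fun n => integrable_mollify n hf) h0
      (fun n x => integral_nonneg fun t =>
        mul_nonneg ((shrinkingBump d n).nonneg_normed _) (h0 _))
      (fun n => integral_mollify n hf) (ae_tendsto_mollify hf.locallyIntegrable)
  have hp := hf.pos_part
  have hn := hf.neg_part
  have h := (key hp fun x => le_max_right _ _).add (key hn fun x => le_max_right _ _)
  rw [add_zero] at h
  refine squeeze_zero (fun n => integral_nonneg fun x => abs_nonneg _) (fun n => ?_) h
  have hip := ((integrable_mollify n hp).sub hp).abs
  have hin := ((integrable_mollify n hn).sub hn).abs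
  refine (integral_mono ((integrable_mollify n hf).sub hf).abs (hip.add hin) fun x => ?_).trans_eq
    (integral_add hip hin)
  have hfd : f = fun y => max (f y) 0 - max (-f y) 0 := by
    ext y
    rcases le_total 0 (f y) with h | h <;> simp [h]
  have e1 : mollify n f x = mollify n (fun y => max (f y) 0) x - mollify n (fun y => max (-f y) 0) x
      := by
    conv_lhs => rw [hfd]
    exact mollify_sub n hp.locallyIntegrable hn.locallyIntegrable x
  have e2 := congrFun hfd x
  simp only [Pi.add_apply, Pi.sub_apply] at e2 ⊢
  calc |mollify n f x - f x|
      = |(mollify n (fun y => max (f y) 0) x - max (f x) 0)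
          - (mollify n (fun y => max (-f y) 0) x - max (-f x) 0)| := by
        rw [e1]; congr 1; linarith [e2]
    _ ≤ _ := abs_sub _ _

/-- The bumps live in the unit ball, so only values within distance one of `x` enter. This reduces
locally integrable functions to integrable ones. -/
theorem mollify_indicator_eq (n : ℕ) (f : Space d → ℝ) {R : ℝ} {x : Space d} (hx : ‖x‖ ≤ R) :
    mollify n ((Metric.closedBall 0 (R + 1)).indicator f) x = mollify n f x := by
  rw [mollify_apply, mollify_apply]
  congr 1; ext t
  by_cases ht : t ∈ Metric.ball (0 : Space d) (shrinkingBump d n).rOut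
  · have h1 : x - t ∈ Metric.closedBall (0 : Space d) (R + 1) := by
      rw [mem_closedBall_zero_iff]
      rw [mem_ball_zero_iff] at ht
      exact (norm_sub_le _ _).trans (add_le_add hx (ht.le.trans (shrinkingBump_rOut_le d n)))
    rw [Set.indicator_of_mem h1]
  · have : (shrinkingBump d n).normed volume t = 0 := by
      rw [← Function.notMem_support, ContDiffBump.support_normed_eq]; exact ht
    rw [this, zero_mul, zero_mul]

/-- Mollifications of a locally integrable function converge in `L¹` on compact sets. -/
theorem tendsto_integral_mul_abs_mollify_sub {v w : Space d → ℝ} (hv : LocallyIntegrable v volume)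
    (hw : Continuous w) (hws : HasCompactSupport w) (hw0 : ∀ x, 0 ≤ w x) :
    Tendsto (fun n => ∫ x, w x * |mollify n v x - v x|) atTop (𝓝 0) := by
  obtain ⟨R, hR⟩ := hws.isCompact.isBounded.subset_closedBall (0 : Space d)
  obtain ⟨M, hM⟩ := hw.bounded_above_of_compact_support hws
  set f := (Metric.closedBall (0 : Space d) (R + 1)).indicator v with hfdef
  have hf : Integrable f :=
    (integrable_indicator_iff Metric.isClosed_closedBall.measurableSet).2
      (hv.integrableOn_isCompact (isCompact_closedBall _ _))
  have h := (tendsto_integral_abs_mollify_sub hf).const_mul M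
  rw [mul_zero] at h
  refine squeeze_zero (fun n => integral_nonneg fun x => mul_nonneg (hw0 x) (abs_nonneg _))
    (fun n => ?_) h
  rw [← integral_const_mul]
  refine integral_mono_of_nonneg
    (Eventually.of_forall fun x => mul_nonneg (hw0 x) (abs_nonneg _))
    (((integrable_mollify n hf).sub hf).abs.const_mul M) (Eventually.of_forall fun x => ?_)
  by_cases hx : x ∈ tsupport w
  · have hxR : ‖x‖ ≤ R := mem_closedBall_zero_iff.1 (hR hx)
    have h1 : f x = v x :=
      Set.indicator_of_mem (mem_closedBall_zero_iff.2 (hxR.trans (by linarith))) _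
    simp only
    rw [h1, hfdef, mollify_indicator_eq n v hxR]
    gcongr
    exact (le_abs_self _).trans (hM x)
  · simp only
    rw [image_eq_zero_of_notMem_tsupport hx, zero_mul]
    exact mul_nonneg ((norm_nonneg _).trans (hM x)) (abs_nonneg _)

/-- The derivative falls on the bump, and `y ↦ φ(x - y)` is an admissible test function; the sign
from the reflection cancels the one in the weak derivative. -/
theorem fderiv_mollify_apply {j : Fin d} {u v : Space d → ℝ} (h : HasWeakPartialDeriv j u v)
    (n : ℕ) (x : Space d) :
    fderiv ℝ (mollify n u) x (EuclideanSpace.single j 1) = mollify n v x := by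
  set φ := (shrinkingBump d n).normed (volume : Measure (Space d)) with hφ
  have hφc : ContDiff ℝ ∞ φ := (shrinkingBump d n).contDiff_normed
  have hφs : HasCompactSupport φ := (shrinkingBump d n).hasCompactSupport_normed
  have h1 := (hφs.hasFDerivAt_convolution_left (ContinuousLinearMap.lsmul ℝ ℝ)
    (hφc.of_le (by exact_mod_cast le_top)) h.locallyIntegrable x (μ := volume)).fderiv
  have hs : HasCompactSupport (fun y => φ (x - y)) := hφs.comp_homeomorph (Homeomorph.subLeft x)
  have h2 := h.integral_eq (fun y => φ (x - y)) (hφc.comp (contDiff_const.sub contDiff_id)) hs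
  have h3 : ∀ y, fderiv ℝ (fun y => φ (x - y)) y (EuclideanSpace.single j 1) =
      - fderiv ℝ φ (x - y) (EuclideanSpace.single j 1) := fun y => by
    have := (hφc.differentiable (by simp) (x - y)).hasFDerivAt.comp y
      ((hasFDerivAt_const x y).sub (hasFDerivAt_id y))
    rw [show (fun y => φ (x - y)) = φ ∘ fun y => x - y from rfl]
    erw [this.fderiv]
    simp
  simp_rw [h3, neg_smul, integral_neg, neg_inj] at h2
  rw [mollify_apply_swap, mollify, h1, convolution_eq_swap]
  refine Eq.trans ?_ h2
  rw [ContinuousLinearMap.integral_apply]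
  · rfl
  · have hc : HasCompactSupport (fderiv ℝ φ) := hφs.fderiv ℝ
    have hcc : Continuous (fderiv ℝ φ) := hφc.continuous_fderiv (by simp)
    have := ConvolutionExistsAt.integrable_swap
      (hc.convolutionExists_left ((ContinuousLinearMap.lsmul ℝ ℝ).precompL (Space d)) hcc
        h.locallyIntegrable (μ := volume) x)
    exact this

/-- Chain and product rule for weak derivatives: if `∂_j u = v` weakly, `g` is bounded and `C¹` with
bounded derivative, and `e` is smooth, then `∂_j (g(u) e) = g'(u) v e + g(u) ∂_j e` weakly. -/
theorem integral_fderiv_smul_comp_smul {F : Type*} [NormedAddCommGroup F] [NormedSpace ℝ F]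
    {j : Fin d} {u v : Space d → ℝ} (h : HasWeakPartialDeriv j u v)
    {g : ℝ → ℝ} (hg : ContDiff ℝ 1 g) {C C' : ℝ} (hC : ∀ r, |g r| ≤ C) (hC' : ∀ r, |deriv g r| ≤ C')
    {e : Space d → F} (he : ContDiff ℝ ∞ e) {φ : Space d → ℝ} (hφ : ContDiff ℝ ∞ φ)
    (hφs : HasCompactSupport φ) :
    ∫ x, (fderiv ℝ φ x (EuclideanSpace.single j 1)) • (g (u x) • e x) =
      - ∫ x, φ x • ((deriv g (u x) * v x) • e x +
        g (u x) • fderiv ℝ e x (EuclideanSpace.single j 1)) := by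
  set s : Space d := EuclideanSpace.single j 1
  have hg' : Continuous (deriv g) := hg.continuous_deriv (by simp)
  have hu := h.locallyIntegrable
  have hv := h.locallyIntegrable_deriv
  have hum := hu.aestronglyMeasurable
  have hvm := hv.aestronglyMeasurable
  have hec := he.continuous
  have he' : Continuous fun x => fderiv ℝ e x s :=
    (he.continuous_fderiv (by simp)).clm_apply continuous_const
  have hφ' : Continuous fun x => fderiv ℝ φ x s :=
    (hφ.continuous_fderiv (by simp)).clm_apply continuous_const
  have hφs' : HasCompactSupport fun x => fderiv ℝ φ x s := hφs.fderiv_apply ℝ _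
  have hφc := hφ.continuous
  have hun : ∀ n, ContDiff ℝ ∞ (mollify n u) := fun n => contDiff_mollify n hu
  have hunc : ∀ n, Continuous (mollify n u) := fun n => (hun n).continuous
  have hvnc : ∀ n, Continuous (mollify n v) := fun n => (contDiff_mollify n hv).continuous
  have hlim := ae_tendsto_mollify hu
  -- For the mollified function the identity is classical integration by parts. The three integrals
  -- are then passed to the limit one by one.
  have hsmooth : ∀ n, ∫ x, fderiv ℝ φ x s • (g (mollify n u x) • e x) =
      - ((∫ x, (φ x * (deriv g (mollify n u x) * mollify n v x)) • e x) +
        ∫ x, φ x • g (mollify n u x) • fderiv ℝ e x s) := fun n => by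
    have hgd : ∀ x, HasFDerivAt (fun x => g (mollify n u x))
        (deriv g (mollify n u x) • fderiv ℝ (mollify n u) x) x := fun x =>
      ((hg.differentiable (by simp) _).hasDerivAt).comp_hasFDerivAt x
        ((hun n).differentiable (by simp) x).hasFDerivAt
    have hwd : ∀ x, HasFDerivAt (fun x => g (mollify n u x) • e x)
        (g (mollify n u x) • fderiv ℝ e x +
          (deriv g (mollify n u x) • fderiv ℝ (mollify n u) x).smulRight (e x)) x := fun x =>
      (hgd x).smul (he.differentiable (by simp) x).hasFDerivAt
    have hws : ∀ x, fderiv ℝ (fun x => g (mollify n u x) • e x) x s =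
        (deriv g (mollify n u x) * mollify n v x) • e x
          + g (mollify n u x) • fderiv ℝ e x s := fun x => by
      rw [(hwd x).fderiv, ← fderiv_mollify_apply h]
      simp [add_comm, s]
    have i1 : Integrable (fun x => (φ x * (deriv g (mollify n u x) * mollify n v x)) • e x)
        volume := by
      refine Continuous.integrable_of_hasCompactSupport ?_ ?_
      · exact (hφc.mul ((hg'.comp (hunc n)).mul (hvnc n))).smul hec
      · exact (hφs.mul_right).smul_right
    have i2 : Integrable (fun x => φ x • g (mollify n u x) • fderiv ℝ e x s) volume := by
      refine Continuous.integrable_of_hasCompactSupport ?_ hφs.smul_right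
      exact hφc.smul ((hg.continuous.comp (hunc n)).smul he')
    have hsum : ∀ x, φ x • fderiv ℝ (fun x => g (mollify n u x) • e x) x s =
        (φ x * (deriv g (mollify n u x) * mollify n v x)) • e x +
          φ x • g (mollify n u x) • fderiv ℝ e x s := fun x => by
      rw [hws, smul_add, smul_smul]
    have := integral_smul_fderiv_eq_neg_fderiv_smul_of_integrable (μ := volume) (f := φ)
      (g := fun x => g (mollify n u x) • e x) (v := s)
      (Continuous.integrable_of_hasCompactSupport
        (hφ'.smul ((hg.continuous.comp (hunc n)).smul hec)) hφs'.smul_right)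
      (by simp_rw [hsum]; exact i1.add i2)
      (Continuous.integrable_of_hasCompactSupport
        (hφc.smul ((hg.continuous.comp (hunc n)).smul hec)) hφs.smul_right)
      (fun x _ => hφ.differentiable (by simp) x) (fun x _ => (hwd x).differentiableAt)
    rw [← integral_add i1 i2]
    simp_rw [← hsum]
    rw [this, neg_neg]
  have t1 : Tendsto (fun n => ∫ x, fderiv ℝ φ x s • (g (mollify n u x) • e x)) atTop
      (𝓝 (∫ x, fderiv ℝ φ x s • (g (u x) • e x))) := by
    refine tendsto_integral_of_dominated_convergence (fun x => C * ‖fderiv ℝ φ x s • e x‖)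
      (fun n => (hφ'.smul ((hg.continuous.comp (hunc n)).smul hec)).aestronglyMeasurable)
      ((Continuous.integrable_of_hasCompactSupport (hφ'.smul hec) hφs'.smul_right).norm.const_mul C)
      (fun n => Eventually.of_forall fun x => ?_) ?_
    · rw [smul_comm, norm_smul]
      gcongr
      exact hC _
    · filter_upwards [hlim] with x hx
      exact (((hg.continuous.tendsto _).comp hx).smul_const _).const_smul _
  have t2 : Tendsto (fun n => ∫ x, φ x • g (mollify n u x) • fderiv ℝ e x s) atTop
      (𝓝 (∫ x, φ x • g (u x) • fderiv ℝ e x s)) := by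
    refine tendsto_integral_of_dominated_convergence (fun x => C * ‖φ x • fderiv ℝ e x s‖)
      (fun n => (hφc.smul ((hg.continuous.comp (hunc n)).smul he')).aestronglyMeasurable)
      ((Continuous.integrable_of_hasCompactSupport (hφc.smul he') hφs.smul_right).norm.const_mul C)
      (fun n => Eventually.of_forall fun x => ?_) ?_
    · rw [smul_comm, norm_smul]
      gcongr
      exact hC _
    · filter_upwards [hlim] with x hx
      exact (((hg.continuous.tendsto _).comp hx).smul_const _).const_smul _
  set w : Space d → ℝ := fun x => |φ x| * ‖e x‖ with hw
  have hwc : Continuous w := hφc.abs.mul hec.norm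
  have hws : HasCompactSupport w := by
    have : HasCompactSupport fun x => |φ x| := hφs.comp_left (g := fun r => |r|) abs_zero
    exact this.mul_right
  have hw0 : ∀ x, 0 ≤ w x := fun x => by positivity
  have hC0 : 0 ≤ C' := (abs_nonneg _).trans (hC' 0)
  have hwv : Integrable (fun x => w x * |v x|) volume := by
    have := (hv.integrable_smul_left_of_hasCompactSupport hwc hws).abs
    refine this.congr (Eventually.of_forall fun x => ?_)
    simp only [smul_eq_mul]
    rw [abs_mul, abs_of_nonneg (hw0 x)]
  have m3 : AEStronglyMeasurable (fun x => (φ x * (deriv g (u x) * v x)) • e x) volume :=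
    (hφc.aestronglyMeasurable.mul
      ((hg'.comp_aestronglyMeasurable hum).mul hvm)).smul hec.aestronglyMeasurable
  -- Here both factors vary. Replacing `mollify n v` by `v` costs at most `C'` times a local `L¹`
  -- error; afterwards only `deriv g (mollify n u)` moves, and dominated convergence applies.
  have t3 : Tendsto (fun n => ∫ x, (φ x * (deriv g (mollify n u x) * mollify n v x)) • e x) atTop
      (𝓝 (∫ x, (φ x * (deriv g (u x) * v x)) • e x)) := by
    have s1 : Tendsto (fun n => ∫ x, w x * |mollify n v x - v x|) atTop (𝓝 0) :=
      tendsto_integral_mul_abs_mollify_sub hv hwc hws hw0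
    have s2 : Tendsto (fun n => ∫ x, (φ x * (deriv g (mollify n u x) * v x)) • e x) atTop
        (𝓝 (∫ x, (φ x * (deriv g (u x) * v x)) • e x)) := by
      refine tendsto_integral_of_dominated_convergence (fun x => C' * (w x * |v x|))
        (fun n => (hφc.aestronglyMeasurable.mul
          ((hg'.comp (hunc n)).aestronglyMeasurable.mul hvm)).smul hec.aestronglyMeasurable)
        (hwv.const_mul C') (fun n => Eventually.of_forall fun x => ?_) ?_
      · rw [norm_smul, norm_mul, norm_mul, Real.norm_eq_abs, Real.norm_eq_abs, Real.norm_eq_abs]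
        calc |φ x| * (|deriv g (mollify n u x)| * |v x|) * ‖e x‖
            ≤ |φ x| * (C' * |v x|) * ‖e x‖ := by gcongr; exact hC' _
          _ = _ := by rw [hw]; ring
      · filter_upwards [hlim] with x hx
        exact (((((hg'.tendsto _).comp hx).mul_const _).const_mul _)).smul_const _
    have s3 : Tendsto (fun n => (∫ x, (φ x * (deriv g (mollify n u x) * mollify n v x)) • e x) -
        ∫ x, (φ x * (deriv g (mollify n u x) * v x)) • e x) atTop (𝓝 0) := by
      refine squeeze_zero_norm (fun n => ?_) (by simpa using s1.const_mul C')
      have i1 : Integrable (fun x => (φ x * (deriv g (mollify n u x) * mollify n v x)) • e x)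
          volume :=
        Continuous.integrable_of_hasCompactSupport
          ((hφc.mul ((hg'.comp (hunc n)).mul (hvnc n))).smul hec) (hφs.mul_right).smul_right
      have i2 : Integrable (fun x => (φ x * (deriv g (mollify n u x) * v x)) • e x) volume := by
        refine (hwv.const_mul C').mono' ((hφc.aestronglyMeasurable.mul
          ((hg'.comp (hunc n)).aestronglyMeasurable.mul hvm)).smul hec.aestronglyMeasurable)
          (Eventually.of_forall fun x => ?_)
        rw [norm_smul, norm_mul, norm_mul, Real.norm_eq_abs, Real.norm_eq_abs, Real.norm_eq_abs]
        calc |φ x| * (|deriv g (mollify n u x)| * |v x|) * ‖e x‖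
            ≤ |φ x| * (C' * |v x|) * ‖e x‖ := by gcongr; exact hC' _
          _ = _ := by rw [hw]; ring
      rw [← integral_sub i1 i2, ← integral_const_mul]
      refine norm_integral_le_of_norm_le ?_ (Eventually.of_forall fun x => ?_)
      · have i3 : Integrable (fun x => w x * mollify n v x) volume :=
          (hwc.mul (hvnc n)).integrable_of_hasCompactSupport hws.mul_right
        have i4 := ((i3.sub (hv.integrable_smul_left_of_hasCompactSupport hwc hws)).abs).const_mul C'
        refine i4.congr (Eventually.of_forall fun x => ?_)
        simp only [Pi.sub_apply, smul_eq_mul]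
        rw [← mul_sub, abs_mul, abs_of_nonneg (hw0 x)]
      · rw [← sub_smul, ← mul_sub, ← mul_sub, norm_smul, norm_mul, norm_mul, Real.norm_eq_abs,
          Real.norm_eq_abs, Real.norm_eq_abs]
        calc |φ x| * (|deriv g (mollify n u x)| * |mollify n v x - v x|) * ‖e x‖
            ≤ |φ x| * (C' * |mollify n v x - v x|) * ‖e x‖ := by gcongr; exact hC' _
          _ = _ := by rw [hw]; ring
    simpa using s3.add s2
  have hfinal := tendsto_nhds_unique t1
    ((t3.add t2).neg.congr fun n => (hsmooth n).symm)
  rw [hfinal, ← integral_add]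
  · simp_rw [smul_add, smul_smul]
  · refine (hwv.const_mul C').mono' m3 (Eventually.of_forall fun x => ?_)
    rw [norm_smul, norm_mul, norm_mul, Real.norm_eq_abs, Real.norm_eq_abs, Real.norm_eq_abs]
    calc |φ x| * (|deriv g (u x)| * |v x|) * ‖e x‖
        ≤ |φ x| * (C' * |v x|) * ‖e x‖ := by gcongr; exact hC' _
      _ = _ := by rw [hw]; ring
  · refine ((Continuous.integrable_of_hasCompactSupport (hφc.smul he')
      hφs.smul_right).norm.const_mul C).mono' ?_ (Eventually.of_forall fun x => ?_)
    · exact hφc.aestronglyMeasurable.smul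
        ((hg.continuous.comp_aestronglyMeasurable hum).smul he'.aestronglyMeasurable)
    · rw [smul_comm, norm_smul]
      exact mul_le_mul_of_nonneg_right (hC _) (norm_nonneg _)

end ChainRule

/-! ### The Gaussian profile in the logarithm of the density, and its moments. -/

section Profile

open ProbabilityTheory Filter Topology
open scoped NNReal

/-- The mean of the normal law (in the variable `y`) whose density is `profile v y r ^ 2`. -/
noncomputable def profileMean (v : ℝ≥0) (r : ℝ) : ℝ := 2 * Real.log r - v / 2

/-- The square root of the Gaussian density in `y` with mean `2 log r - v / 2` and variance `v`,
extended by zero to `r ≤ 0`. -/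
noncomputable def profile (v : ℝ≥0) (y r : ℝ) : ℝ :=
  if 0 < r then √(√(2 * Real.pi * v))⁻¹ * Real.exp (-(y - profileMean v r) ^ 2 / (4 * v)) else 0

/-- The derivative of `profile v y r` in `r`. -/
noncomputable def profileDeriv (v : ℝ≥0) (y r : ℝ) : ℝ :=
  if 0 < r then (y - profileMean v r) / (v * r) * profile v y r else 0

variable {v : ℝ≥0}

theorem profile_of_nonpos {y r : ℝ} (h : r ≤ 0) : profile v y r = 0 := if_neg h.not_gt

theorem profileDeriv_of_nonpos {y r : ℝ} (h : r ≤ 0) : profileDeriv v y r = 0 := if_neg h.not_gt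

theorem profile_of_pos {y r : ℝ} (h : 0 < r) : profile v y r =
    √(√(2 * Real.pi * v))⁻¹ * Real.exp (-(y - profileMean v r) ^ 2 / (4 * v)) := if_pos h

theorem profileDeriv_of_pos {y r : ℝ} (h : 0 < r) : profileDeriv v y r =
    (y - profileMean v r) / (v * r) * profile v y r := if_pos h

theorem profile_nonneg (y r : ℝ) : 0 ≤ profile v y r := by
  unfold profile; split_ifs <;> positivity

theorem profile_sq (hv : v ≠ 0) {y r : ℝ} (h : 0 < r) :
    profile v y r ^ 2 = gaussianPDFReal (profileMean v r) v y := by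
  have hv' : (0 : ℝ) < v := by positivity
  rw [profile_of_pos h, mul_pow, Real.sq_sqrt (by positivity), ← Real.exp_nat_mul, gaussianPDFReal]
  congr 2
  push_cast
  field_simp
  ring

/-- Every power of `r` dominates the profile near `r = 0`. -/
theorem exists_profile_le (hv : v ≠ 0) (y : ℝ) (k : ℕ) :
    ∃ K : ℝ, 0 ≤ K ∧
      ∀ r, 0 < r → (1 + |y - profileMean v r|) * profile v y r ≤ K * r ^ k := by
  have hv' : (0 : ℝ) < v := by positivity
  -- With `t = y - profileMean v r` one has `r = exp((y + v/2 - t)/2)`, so dividing by `r^k` and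
  -- using `1 + |t| ≤ e^{|t|}` costs an exponent of at most `(1 + k/2)|t|` up to a constant. The
  -- term `v (1 + k/2)²` is the maximum of `(1 + k/2)|t| - t²/(4v)`.
  refine ⟨√(√(2 * Real.pi * v))⁻¹ * Real.exp (v * (1 + k / 2) ^ 2 - k * (y + v / 2) / 2),
    by positivity, fun r hr => ?_⟩
  rw [profile_of_pos hr]
  set t := y - profileMean v r with ht
  have hrk : r ^ k = Real.exp (k * ((y + v / 2 - t) / 2)) := by
    rw [ht, profileMean, Real.exp_nat_mul]
    congr 1
    rw [show (y + v / 2 - (y - (2 * Real.log r - v / 2))) / 2 = Real.log r by ring,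
      Real.exp_log hr]
  have h1 : 1 + |t| ≤ Real.exp |t| := by linarith [Real.add_one_le_exp |t|]
  calc (1 + |t|) * (√(√(2 * Real.pi * v))⁻¹ * Real.exp (-t ^ 2 / (4 * v)))
      ≤ Real.exp |t| * (√(√(2 * Real.pi * v))⁻¹ * Real.exp (-t ^ 2 / (4 * v))) := by gcongr
    _ = √(√(2 * Real.pi * v))⁻¹ * Real.exp (|t| + -t ^ 2 / (4 * v)) := by
        rw [Real.exp_add]; ring
    _ ≤ √(√(2 * Real.pi * v))⁻¹ * Real.exp ((v * (1 + k / 2) ^ 2 - k * (y + v / 2) / 2) +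
          k * ((y + v / 2 - t) / 2)) := by
        refine mul_le_mul_of_nonneg_left (Real.exp_le_exp.2 ?_) (by positivity)
        have h2 : (1 + (k : ℝ) / 2) * |t| ≤ v * (1 + k / 2) ^ 2 + t ^ 2 / (4 * v) := by
          have : 0 ≤ (2 * v * (1 + (k : ℝ) / 2) - |t|) ^ 2 / (4 * v) := by positivity
          have e : (2 * v * (1 + (k : ℝ) / 2) - |t|) ^ 2 / (4 * v) =
              v * (1 + k / 2) ^ 2 - (1 + k / 2) * |t| + t ^ 2 / (4 * v) := by
            rw [← sq_abs t]
            field_simp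
            ring
          linarith
        have h3 : (k : ℝ) / 2 * t ≤ k / 2 * |t| := by gcongr; exact le_abs_self t
        rw [neg_div]
        linarith
    _ = _ := by rw [Real.exp_add, hrk]; ring

theorem exists_profile_le_mul (hv : v ≠ 0) (y : ℝ) (k : ℕ) :
    ∃ K : ℝ, 0 ≤ K ∧ ∀ r, 0 < r → profile v y r ≤ K * r ^ k := by
  obtain ⟨K, hK, h⟩ := exists_profile_le hv y k
  refine ⟨K, hK, fun r hr => le_trans ?_ (h r hr)⟩
  exact le_mul_of_one_le_left (profile_nonneg _ _) (by linarith [abs_nonneg (y - profileMean v r)])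

theorem exists_abs_profileDeriv_le_mul (hv : v ≠ 0) (y : ℝ) (k : ℕ) :
    ∃ K : ℝ, 0 ≤ K ∧ ∀ r, 0 < r → |profileDeriv v y r| ≤ K * r ^ k := by
  have hv' : (0 : ℝ) < v := by positivity
  -- The extra power compensates the factor `1/r` in the derivative.
  obtain ⟨K, hK, h⟩ := exists_profile_le hv y (k + 1)
  refine ⟨K / v, by positivity, fun r hr => ?_⟩
  rw [profileDeriv_of_pos hr, abs_mul, abs_div, abs_of_pos (mul_pos hv' hr),
    abs_of_nonneg (profile_nonneg _ _), div_mul_eq_mul_div, div_le_iff₀ (by positivity)]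
  calc |y - profileMean v r| * profile v y r
      ≤ (1 + |y - profileMean v r|) * profile v y r := by
        gcongr
        · exact profile_nonneg _ _
        · linarith
    _ ≤ K * r ^ (k + 1) := h r hr
    _ = _ := by field_simp; ring

theorem exists_abs_profile_le (hv : v ≠ 0) (y : ℝ) : ∃ C : ℝ, ∀ r, |profile v y r| ≤ C := by
  obtain ⟨K, hK, h⟩ := exists_profile_le_mul hv y 0
  refine ⟨K, fun r => ?_⟩
  rw [abs_of_nonneg (profile_nonneg _ _)]
  rcases lt_or_ge 0 r with hr | hr
  · simpa using h r hr
  · rwa [profile_of_nonpos hr]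

theorem exists_abs_profileDeriv_le (hv : v ≠ 0) (y : ℝ) :
    ∃ C : ℝ, ∀ r, |profileDeriv v y r| ≤ C := by
  obtain ⟨K, hK, h⟩ := exists_abs_profileDeriv_le_mul hv y 0
  refine ⟨K, fun r => ?_⟩
  rcases lt_or_ge 0 r with hr | hr
  · simpa using h r hr
  · rwa [profileDeriv_of_nonpos hr, abs_zero]

/-- Only `r = 0` is delicate: there the profile is bounded by a multiple of `r²`, so its derivative
vanishes. -/
theorem hasDerivAt_profile (hv : v ≠ 0) (y r : ℝ) :
    HasDerivAt (profile v y) (profileDeriv v y r) r := by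
  have hv' : (0 : ℝ) < v := by positivity
  rcases lt_trichotomy 0 r with hr | rfl | hr
  · have h1 : HasDerivAt (fun r => y - profileMean v r) (-(2 * r⁻¹)) r :=
      (((Real.hasDerivAt_log hr.ne').const_mul 2).sub_const _).const_sub y
    have h2 := ((((h1.pow 2).neg.div_const (4 * (v : ℝ))).exp)).const_mul √(√(2 * Real.pi * v))⁻¹
    have h3 : profile v y =ᶠ[𝓝 r] fun r => √(√(2 * Real.pi * v))⁻¹ *
        Real.exp (-(y - profileMean v r) ^ 2 / (4 * v)) := by
      filter_upwards [lt_mem_nhds hr] with s hs using profile_of_pos hs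
    refine (h2.congr_of_eventuallyEq h3).congr_deriv ?_
    rw [profileDeriv_of_pos hr, profile_of_pos hr]
    simp only [Pi.pow_apply, Pi.neg_apply]
    field_simp
    ring
  · obtain ⟨K, hK, h⟩ := exists_profile_le_mul hv y 2
    rw [profileDeriv_of_nonpos le_rfl, hasDerivAt_iff_isLittleO_nhds_zero]
    have hO : (fun s : ℝ => profile v y (0 + s) - profile v y 0 - s • (0 : ℝ)) =O[𝓝 0]
        fun s : ℝ => s ^ 2 := by
      refine Asymptotics.IsBigO.of_bound K (Eventually.of_forall fun s => ?_)
      rw [profile_of_nonpos (le_refl (0 : ℝ)), zero_add, smul_zero, sub_zero, sub_zero,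
        Real.norm_of_nonneg (profile_nonneg _ _), Real.norm_of_nonneg (sq_nonneg s)]
      rcases lt_or_ge 0 s with hs | hs
      · exact h s hs
      · rw [profile_of_nonpos hs]; positivity
    exact hO.trans_isLittleO (by simpa using Asymptotics.isLittleO_pow_id (𝕜 := ℝ) one_lt_two)
  · rw [profileDeriv_of_nonpos hr.le]
    refine (hasDerivAt_const r (0 : ℝ)).congr_of_eventuallyEq ?_
    filter_upwards [gt_mem_nhds hr] with s hs using profile_of_nonpos hs.le

theorem continuous_profileDeriv (hv : v ≠ 0) (y : ℝ) : Continuous (profileDeriv v y) := by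
  have hv' : (0 : ℝ) < v := by positivity
  have hc : Continuous (profile v y) :=
    continuous_iff_continuousAt.2 fun r => (hasDerivAt_profile hv y r).continuousAt
  refine continuous_iff_continuousAt.2 fun r => ?_
  rcases lt_trichotomy 0 r with hr | rfl | hr
  · have h3 : profileDeriv v y =ᶠ[𝓝 r] fun r =>
        (y - profileMean v r) / (v * r) * profile v y r := by
      filter_upwards [lt_mem_nhds hr] with s hs using profileDeriv_of_pos hs
    refine ContinuousAt.congr ?_ h3.symm
    refine ContinuousAt.mul (ContinuousAt.div ?_ (by fun_prop) (by positivity)) hc.continuousAt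
    unfold profileMean
    have := Real.continuousAt_log hr.ne'
    fun_prop
  · obtain ⟨K, hK, h⟩ := exists_abs_profileDeriv_le_mul hv y 1
    rw [ContinuousAt, profileDeriv_of_nonpos le_rfl]
    refine squeeze_zero_norm (a := fun s => K * |s|) (fun s => ?_) ?_
    · rcases lt_or_ge 0 s with hs | hs
      · rw [abs_of_pos hs]; simpa using h s hs
      · rw [profileDeriv_of_nonpos hs, norm_zero]; positivity
    · have : Continuous fun s : ℝ => K * |s| := by fun_prop
      simpa using this.tendsto 0
  · have h3 : profileDeriv v y =ᶠ[𝓝 r] fun _ => 0 := by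
      filter_upwards [gt_mem_nhds hr] with s hs using profileDeriv_of_nonpos hs.le
    exact continuousAt_const.congr h3.symm

theorem deriv_profile (hv : v ≠ 0) (y : ℝ) : deriv (profile v y) = profileDeriv v y :=
  funext fun r => (hasDerivAt_profile hv y r).deriv

theorem contDiff_profile (hv : v ≠ 0) (y : ℝ) : ContDiff ℝ 1 (profile v y) := by
  rw [contDiff_one_iff_deriv, deriv_profile hv]
  exact ⟨fun r => (hasDerivAt_profile hv y r).differentiableAt, continuous_profileDeriv hv y⟩

theorem measurable_profile : Measurable fun p : ℝ × ℝ => profile v p.1 p.2 := by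
  unfold profile profileMean
  refine Measurable.ite (measurableSet_lt measurable_const measurable_snd) ?_ measurable_const
  fun_prop

theorem measurable_profileDeriv : Measurable fun p : ℝ × ℝ => profileDeriv v p.1 p.2 := by
  unfold profileDeriv
  refine Measurable.ite (measurableSet_lt measurable_const measurable_snd) ?_ measurable_const
  refine Measurable.mul ?_ measurable_profile
  unfold profileMean
  fun_prop

/-- Completing the square: an exponential weight shifts the mean by `p v` and leaves the variance
unchanged. -/
theorem exp_mul_gaussianPDFReal (hv : v ≠ 0) (m p y : ℝ) :
    Real.exp (p * y) * gaussianPDFReal m v y =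
      Real.exp (m * p + v * p ^ 2 / 2) * gaussianPDFReal (m + p * v) v y := by
  have hv' : (0 : ℝ) < v := by positivity
  have : Real.exp (p * y) * Real.exp (-(y - m) ^ 2 / (2 * v)) = Real.exp (m * p + v * p ^ 2 / 2) *
      Real.exp (-(y - (m + p * v)) ^ 2 / (2 * v)) := by
    rw [← Real.exp_add, ← Real.exp_add]
    congr 1
    field_simp
    ring
  rw [gaussianPDFReal, gaussianPDFReal]
  linear_combination (√(2 * Real.pi * v))⁻¹ * this

/-- The shift `-v/2` in the mean produces the exponent `p(p-1)v/2`, which vanishes at both `p = 0`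
(Bessel bound) and `p = 1` (density). The exponent `p = 1 + 2/d` gives the Thomas–Fermi term. -/
theorem lintegral_exp_mul_profile_sq (hv : v ≠ 0) (p : ℝ) {r : ℝ} (hr : 0 < r) :
    ∫⁻ y, ENNReal.ofReal (Real.exp (p * y) * profile v y r ^ 2) =
      ENNReal.ofReal (Real.exp (p * (p - 1) * v / 2) * r ^ (2 * p)) := by
  simp_rw [profile_sq hv hr, exp_mul_gaussianPDFReal hv]
  simp_rw [ENNReal.ofReal_mul (Real.exp_nonneg _)]
  rw [lintegral_const_mul' _ _ ENNReal.ofReal_ne_top, lintegral_gaussianPDFReal_eq_one _ hv,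
    mul_one, ← ENNReal.ofReal_mul (Real.exp_nonneg _)]
  congr 1
  rw [Real.rpow_def_of_pos hr, ← Real.exp_add, profileMean]
  congr 1
  ring

theorem lintegral_profile_sq (hv : v ≠ 0) {r : ℝ} (hr : 0 < r) :
    ∫⁻ y, ENNReal.ofReal (profile v y r ^ 2) = 1 := by
  simpa using lintegral_exp_mul_profile_sq hv 0 hr

/-- The weight `e^y` turns the law into a normal one of mean `m + v` times `r²`, and `r²` cancels
the `1/r²` from the derivative. What is left is `E[(y - m)²]/v² = (v + v²)/v²`, independent of `r`.
-/
theorem lintegral_exp_mul_profileDeriv_sq (hv : v ≠ 0) {r : ℝ} (hr : 0 < r) :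
    ∫⁻ y, ENNReal.ofReal (Real.exp y * profileDeriv v y r ^ 2) =
      ENNReal.ofReal (1 + 1 / v) := by
  have hv' : (0 : ℝ) < v := by positivity
  set m := profileMean v r with hm
  have h1 : ∀ y, Real.exp y * profileDeriv v y r ^ 2 =
      gaussianPDFReal (m + v) v y * ((y - m) ^ 2 / v ^ 2) := fun y => by
    have := exp_mul_gaussianPDFReal hv m 1 y
    rw [one_mul, one_mul, ← profile_sq hv hr] at this
    have h2 : Real.exp (m * 1 + v * 1 ^ 2 / 2) = r ^ 2 := by
      rw [hm, profileMean, show (2 * Real.log r - (v : ℝ) / 2) * 1 + v * 1 ^ 2 / 2 =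
        ((2 : ℕ) : ℝ) * Real.log r by push_cast; ring, Real.exp_nat_mul, Real.exp_log hr]
    rw [h2] at this
    rw [profileDeriv_of_pos hr, mul_pow]
    calc Real.exp y * (((y - m) / (v * r)) ^ 2 * profile v y r ^ 2)
        = ((y - m) / (v * r)) ^ 2 * (Real.exp y * profile v y r ^ 2) := by ring
      _ = _ := by rw [this]; field_simp
  have h2 : ∫ y, (y - m) ^ 2 / v ^ 2 ∂(gaussianReal (m + v) v) = 1 + 1 / v := by
    have hmem : MemLp id 2 (gaussianReal (m + v) v) := by
      simpa using memLp_id_gaussianReal (μ := m + v) (v := v) 2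
    have i1 : Integrable (fun y : ℝ => y) (gaussianReal (m + v) v) := hmem.integrable (by norm_num)
    have hmean : ∫ y, y ∂(gaussianReal (m + v) v) = m + v := integral_id_gaussianReal
    have hvar := variance_id_gaussianReal (μ := m + v) (v := v)
    have hvi : Integrable (fun y : ℝ => (y - (m + v)) ^ 2) (gaussianReal (m + v) v) :=
      (hmem.sub (memLp_const (m + (v : ℝ)))).integrable_sq
    rw [variance_eq_integral measurable_id.aemeasurable] at hvar
    simp only [id_eq, hmean] at hvar
    have e : ∀ y : ℝ, (y - m) ^ 2 / (v : ℝ) ^ 2 =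
        ((v : ℝ) ^ 2)⁻¹ * (y - (m + v)) ^ 2 + (2 / v * y - (2 * m + v) / v) := fun y => by
      field_simp
      ring
    simp_rw [e]
    have i2 : Integrable (fun y : ℝ => 2 / v * y - (2 * m + v) / v) (gaussianReal (m + v) v) :=
      (i1.const_mul _).sub (integrable_const _)
    rw [integral_add (hvi.const_mul _) i2,
      integral_sub (i1.const_mul _) (integrable_const _), integral_const_mul, integral_const_mul,
      hvar, hmean]
    simp
    field_simp
    ring
  have hint : Integrable (fun y : ℝ => (y - m) ^ 2 / (v : ℝ) ^ 2) (gaussianReal (m + v) v) :=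
    (((memLp_id_gaussianReal (μ := m + v) (v := v) 2).sub (memLp_const m)).integrable_sq).div_const _
  rw [← h2, ofReal_integral_eq_lintegral_ofReal hint (Eventually.of_forall fun y => by positivity),
    gaussianReal_of_var_ne_zero _ hv, lintegral_withDensity_eq_lintegral_mul _
      (measurable_gaussianPDF _ _) (by fun_prop)]
  refine lintegral_congr fun y => ?_
  rw [h1, ENNReal.ofReal_mul (gaussianPDFReal_nonneg _ _ _)]
  rfl

end Profile

/-! ### Fermi balls and integration over phase space. -/

section PhaseSpace

open Filter Topology
open scoped NNReal

variable {d q : ℕ}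

/-- The momenta occupied at the spatial density `exp y`: a ball of volume `exp y / q`. -/
def fermiBall (d q : ℕ) (y : ℝ) : Set (Space d) :=
  {k | q * volume.real (Metric.ball (0 : Space d) 1) * ‖k‖ ^ d ≤ Real.exp y}

theorem volume_unitBall_pos : 0 < volume.real (Metric.ball (0 : Space d) 1) :=
  ENNReal.toReal_pos (Metric.measure_ball_pos _ _ one_pos).ne' measure_ball_lt_top.ne

theorem sphereArea_eq : sphereArea d = d * volume.real (Metric.ball (0 : Space d) 1) := by
  rw [sphereArea, Measure.toSphere_real_apply_univ]
  simp

theorem fermiBall_eq (hd : 1 ≤ d) (hq : 1 ≤ q) (y : ℝ) {K : ℝ} (hK : 0 ≤ K)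
    (h : q * volume.real (Metric.ball (0 : Space d) 1) * K ^ d = Real.exp y) :
    fermiBall d q y = Metric.closedBall 0 K := by
  ext k
  have hB := volume_unitBall_pos (d := d)
  have hq' : (0 : ℝ) < q := by positivity
  rw [fermiBall, Set.mem_ofPred_eq, mem_closedBall_zero_iff, ← h,
    mul_le_mul_iff_right₀ (by positivity),
    pow_le_pow_iff_left₀ (norm_nonneg _) hK (by omega)]

/-- The radius is `(e^y / (qB))^{1/d}` with `B` the volume of the unit ball; since `|𝕊^{d-1}| = dB`,
its square exhibits the last factor of `cTF`. -/
theorem exists_fermiRadius (hd : 1 ≤ d) (hq : 1 ≤ q) (y : ℝ) : ∃ K : ℝ, 0 ≤ K ∧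
    q * volume.real (Metric.ball (0 : Space d) 1) * K ^ d = Real.exp y ∧
    K ^ 2 = (q : ℝ) ^ (-(2 / (d : ℝ))) * (d / sphereArea d) ^ (2 / (d : ℝ)) *
      Real.exp (2 / (d : ℝ) * y) := by
  have hB := volume_unitBall_pos (d := d)
  have hq' : (0 : ℝ) < q := by positivity
  have hd' : (0 : ℝ) < d := by positivity
  set B := volume.real (Metric.ball (0 : Space d) 1)
  refine ⟨(Real.exp y / (q * B)) ^ ((d : ℝ)⁻¹), by positivity, ?_, ?_⟩
  · rw [Real.rpow_inv_natCast_pow (by positivity) (by omega)]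
    field_simp
  · rw [← Real.rpow_natCast, ← Real.rpow_mul (by positivity), sphereArea_eq]
    have e1 : (d : ℝ) / (d * B) = B⁻¹ := by field_simp
    rw [e1, Real.rpow_neg hq'.le, ← Real.inv_rpow hq'.le,
      ← Real.mul_rpow (by positivity) (by positivity), mul_comm (2 / (d : ℝ)) y, Real.exp_mul,
      ← Real.mul_rpow (by positivity) (by positivity)]
    congr 1
    · field_simp
    · push_cast; field_simp

theorem mul_volume_fermiBall (hd : 1 ≤ d) (hq : 1 ≤ q) (y : ℝ) :
    (q : ℝ≥0∞) * volume (fermiBall d q y) = ENNReal.ofReal (Real.exp y) := by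
  obtain ⟨K, hK, h, -⟩ := exists_fermiRadius hd hq y
  rw [fermiBall_eq hd hq y hK h, Measure.addHaar_closedBall _ _ hK, ← h, finrank_euclideanSpace_fin,
    ← ofReal_measureReal measure_ball_lt_top.ne, ← ENNReal.ofReal_natCast q,
    ← ENNReal.ofReal_mul (by positivity), ← ENNReal.ofReal_mul (by positivity)]
  congr 1
  ring

/-- In polar coordinates the integral of `|k|²` over the ball of radius `K` is `dB K^{d+2}/(d+2)`;
then `qBK^d = e^y` and the formula for `K²` are inserted. The factor `4π²` comes from plane waves
`e^{2πik·x}`. -/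
theorem mul_lintegral_fermiBall (hd : 1 ≤ d) (hq : 1 ≤ q) (y : ℝ) :
    (q : ℝ≥0∞) * ∫⁻ k in fermiBall d q y, ENNReal.ofReal (4 * Real.pi ^ 2 * ‖k‖ ^ 2) =
      ENNReal.ofReal ((q : ℝ) ^ (-(2 / (d : ℝ))) * cTF d * Real.exp ((1 + 2 / (d : ℝ)) * y)) := by
  obtain ⟨K, hK, h, hK2⟩ := exists_fermiRadius hd hq y
  have hnt : Nontrivial (Space d) := by
    have : Nonempty (Fin d) := ⟨⟨0, by omega⟩⟩
    infer_instance
  rw [fermiBall_eq hd hq y hK h]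
  have hint : IntegrableOn (fun k : Space d => 4 * Real.pi ^ 2 * ‖k‖ ^ 2) (Metric.closedBall 0 K) :=
    (by fun_prop : Continuous fun k : Space d => 4 * Real.pi ^ 2 * ‖k‖ ^ 2).continuousOn.integrableOn_compact
      (isCompact_closedBall _ _)
  rw [← ofReal_integral_eq_lintegral_ofReal hint (Eventually.of_forall fun k => by positivity),
    ← ENNReal.ofReal_natCast q, ← ENNReal.ofReal_mul (by positivity)]
  congr 1
  have h1 : ∫ k in Metric.closedBall (0 : Space d) K, 4 * Real.pi ^ 2 * ‖k‖ ^ 2 =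
      ∫ k : Space d, (Set.Iic K).indicator (fun t => 4 * Real.pi ^ 2 * t ^ 2) ‖k‖ := by
    rw [← integral_indicator Metric.isClosed_closedBall.measurableSet]
    congr 1; ext k
    by_cases hk : ‖k‖ ≤ K <;> simp [Set.indicator, hk]
  have h2 : ∫ t in Set.Ioi (0 : ℝ), t ^ (d - 1) •
      (Set.Iic K).indicator (fun t => 4 * Real.pi ^ 2 * t ^ 2) t =
      4 * Real.pi ^ 2 * (K ^ (d + 2) / (d + 2)) := by
    have e : ∀ t : ℝ, t ^ (d - 1) • (Set.Iic K).indicator (fun t => 4 * Real.pi ^ 2 * t ^ 2) t =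
        (Set.Iic K).indicator (fun t => 4 * Real.pi ^ 2 * t ^ (d + 1)) t := fun t => by
      by_cases ht : t ∈ Set.Iic K
      · rw [Set.indicator_of_mem ht, Set.indicator_of_mem ht, smul_eq_mul,
          show d + 1 = (d - 1) + 2 by omega, pow_add]
        ring
      · rw [Set.indicator_of_notMem ht, Set.indicator_of_notMem ht, smul_zero]
    simp_rw [e]
    rw [setIntegral_indicator measurableSet_Iic, Set.Ioi_inter_Iic,
      ← intervalIntegral.integral_of_le hK, intervalIntegral.integral_const_mul, integral_pow]
    push_cast
    rw [zero_pow (by omega)]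
    ring
  rw [h1, integral_fun_norm_addHaar volume
    ((Set.Iic K).indicator (fun t => 4 * Real.pi ^ 2 * t ^ 2)), finrank_euclideanSpace_fin, h2]
  set B := volume.real (Metric.ball (0 : Space d) 1)
  rw [cTF, add_mul, one_mul, Real.exp_add, ← h]
  simp only [nsmul_eq_mul, smul_eq_mul]
  have hd' : (0 : ℝ) < d := by positivity
  calc (q : ℝ) * (d * (B * (4 * Real.pi ^ 2 * (K ^ (d + 2) / (d + 2)))))
      = q * B * K ^ d * (4 * Real.pi ^ 2 * d / (d + 2)) * K ^ 2 := by rw [pow_add]; ring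
    _ = _ := by rw [hK2]; ring

theorem measurableSet_fermiBall {y : ℝ} : MeasurableSet (fermiBall d q y) := by
  have h : fermiBall d q y = {k : Space d | q * volume.real (Metric.ball (0 : Space d) 1) *
      ‖k‖ ^ d ≤ Real.exp y} := rfl
  rw [h]
  exact measurableSet_le (by fun_prop) (by fun_prop)

/-- The region of phase space `{(y, k)}` occupied by the trial state. -/
def fermiRegion (d q : ℕ) : Set (ℝ × Space d) := {z | z.2 ∈ fermiBall d q z.1}

theorem measurableSet_fermiRegion : MeasurableSet (fermiRegion d q) := by
  have h : fermiRegion d q = {z : ℝ × Space d | q * volume.real (Metric.ball (0 : Space d) 1) *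
      ‖z.2‖ ^ d ≤ Real.exp z.1} := rfl
  rw [h]
  exact measurableSet_le (by fun_prop) (by fun_prop)

/-- The measure on the parameters `((y, k), σ)` of the trial state. -/
noncomputable def phaseMeasure (d q : ℕ) : Measure ((ℝ × Space d) × Fin q) :=
  (volume.restrict (fermiRegion d q)).prod Measure.count

instance : SFinite (phaseMeasure d q) := by unfold phaseMeasure; infer_instance

theorem lintegral_phaseMeasure_eq_setLIntegral {f : ℝ × Space d → ℝ≥0∞} (hf : Measurable f) :
    ∫⁻ a, f a.1 ∂(phaseMeasure d q) = ∫⁻ z in fermiRegion d q, q * f z := by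
  rw [phaseMeasure, lintegral_prod (fun a : (ℝ × Space d) × Fin q => f a.1)
    (hf.comp measurable_fst).aemeasurable]
  refine lintegral_congr fun z => ?_
  simp [lintegral_const, mul_comm]

theorem setLIntegral_fermiRegion {f : ℝ × Space d → ℝ≥0∞} (hf : Measurable f) :
    ∫⁻ z in fermiRegion d q, f z = ∫⁻ y, ∫⁻ k in fermiBall d q y, f (y, k) := by
  rw [← lintegral_indicator measurableSet_fermiRegion, Measure.volume_eq_prod,
    lintegral_prod _ (hf.indicator measurableSet_fermiRegion).aemeasurable]
  refine lintegral_congr fun y => ?_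
  rw [← lintegral_indicator measurableSet_fermiBall]
  refine lintegral_congr fun k => ?_
  by_cases hk : k ∈ fermiBall d q y
  · have hk' : (y, k) ∈ fermiRegion d q := hk
    exact (Set.indicator_of_mem hk' f).trans (Set.indicator_of_mem hk fun k => f (y, k)).symm
  · have hk' : (y, k) ∉ fermiRegion d q := hk
    exact (Set.indicator_of_notMem hk' f).trans
      (Set.indicator_of_notMem hk fun k => f (y, k)).symm

theorem lintegral_phaseMeasure {f : ℝ × Space d → ℝ≥0∞} (hf : Measurable f) :
    ∫⁻ a, f a.1 ∂(phaseMeasure d q) = ∫⁻ y, q * ∫⁻ k in fermiBall d q y, f (y, k) := by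
  rw [lintegral_phaseMeasure_eq_setLIntegral hf, setLIntegral_fermiRegion (hf.const_mul _)]
  refine lintegral_congr fun y => ?_
  exact lintegral_const_mul _ (hf.comp measurable_prodMk_left)

variable {v : ℝ≥0}

theorem measurable_profile_right (r : ℝ) : Measurable fun y => profile v y r :=
  measurable_profile.comp (measurable_id.prodMk measurable_const)

theorem measurable_profileDeriv_right (r : ℝ) : Measurable fun y => profileDeriv v y r :=
  measurable_profileDeriv.comp (measurable_id.prodMk measurable_const)

/-- Integrating out momentum and spin leaves the weight `e^y`, so this is the first moment `p = 1`:
the trial state has the prescribed density. -/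
theorem lintegral_phaseMeasure_profile_sq (hd : 1 ≤ d) (hq : 1 ≤ q) (hv : v ≠ 0) {r : ℝ}
    (hr : 0 ≤ r) :
    ∫⁻ a, ENNReal.ofReal (profile v a.1.1 r ^ 2) ∂(phaseMeasure d q) = ENNReal.ofReal (r ^ 2) := by
  have hm := measurable_profile_right (v := v) r
  rw [lintegral_phaseMeasure (f := fun z : ℝ × Space d => ENNReal.ofReal (profile v z.1 r ^ 2))
    (by fun_prop)]
  simp only [lintegral_const, Measure.restrict_apply_univ]
  have e : ∀ y, (q : ℝ≥0∞) * (ENNReal.ofReal (profile v y r ^ 2) * volume (fermiBall d q y)) =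
      ENNReal.ofReal (Real.exp (1 * y) * profile v y r ^ 2) := fun y => by
    rw [mul_left_comm, mul_volume_fermiBall hd hq, mul_comm, ← ENNReal.ofReal_mul (by positivity),
      one_mul]
  simp_rw [e]
  rcases hr.eq_or_lt with rfl | hr
  · simp [profile_of_nonpos]
  · rw [lintegral_exp_mul_profile_sq hv 1 hr]
    congr 1
    have : r ^ ((2 : ℝ) * 1) = r ^ 2 := by rw [mul_one, Real.rpow_two]
    rw [this]
    simp

/-- This is the energy density at one point, with `r = u(x)` and `W` standing for `|∇u(x)|²`. For `r
> 0` both moments are exact; only at `r = 0`, where the profile and its derivative vanish, is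
something discarded. -/
theorem lintegral_phaseMeasure_energy_le (hd : 1 ≤ d) (hq : 1 ≤ q) (hv : v ≠ 0) {r : ℝ}
    (hr : 0 ≤ r) (W : ℝ≥0∞) :
    ∫⁻ a, (ENNReal.ofReal (profileDeriv v a.1.1 r ^ 2) * W +
        ENNReal.ofReal (4 * Real.pi ^ 2 * ‖a.1.2‖ ^ 2) * ENNReal.ofReal (profile v a.1.1 r ^ 2))
        ∂(phaseMeasure d q) ≤
      ENNReal.ofReal ((q : ℝ) ^ (-(2 / (d : ℝ))) * cTF d *
          Real.exp ((1 + 2 / (d : ℝ)) * (2 / (d : ℝ)) * v / 2)) *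
        ENNReal.ofReal (r ^ (2 * (1 + 2 / (d : ℝ)))) +
      ENNReal.ofReal (1 + 1 / v) * W := by
  have hm := measurable_profile_right (v := v) r
  have hm' := measurable_profileDeriv_right (v := v) r
  rw [lintegral_phaseMeasure (f := fun z : ℝ × Space d =>
    ENNReal.ofReal (profileDeriv v z.1 r ^ 2) * W +
        ENNReal.ofReal (4 * Real.pi ^ 2 * ‖z.2‖ ^ 2) * ENNReal.ofReal (profile v z.1 r ^ 2))
    (by fun_prop)]
  have hc : 0 ≤ (q : ℝ) ^ (-(2 / (d : ℝ))) * cTF d := by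
    have hB := volume_unitBall_pos (d := d)
    have : 0 ≤ cTF d := by
      rw [cTF, sphereArea_eq]
      positivity
    positivity
  have e : ∀ y, (q : ℝ≥0∞) * ∫⁻ k in fermiBall d q y,
      (ENNReal.ofReal (profileDeriv v y r ^ 2) * W +
        ENNReal.ofReal (4 * Real.pi ^ 2 * ‖k‖ ^ 2) * ENNReal.ofReal (profile v y r ^ 2)) =
      ENNReal.ofReal (Real.exp y * profileDeriv v y r ^ 2) * W +
      ENNReal.ofReal ((q : ℝ) ^ (-(2 / (d : ℝ))) * cTF d) *
        ENNReal.ofReal (Real.exp ((1 + 2 / (d : ℝ)) * y) * profile v y r ^ 2) := fun y => by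
    rw [lintegral_add_left measurable_const, lintegral_const, Measure.restrict_apply_univ,
      lintegral_mul_const _ (by fun_prop), mul_add, ← mul_assoc (q : ℝ≥0∞) (lintegral _ _),
      mul_lintegral_fermiBall hd hq, mul_left_comm, mul_volume_fermiBall hd hq]
    rw [mul_right_comm, ← ENNReal.ofReal_mul (by positivity), mul_comm (Real.exp y),
      ← ENNReal.ofReal_mul' (by positivity), ← ENNReal.ofReal_mul hc, mul_assoc _ (Real.exp _)]
  simp_rw [e]
  rw [lintegral_add_left (by fun_prop), lintegral_mul_const _ (by fun_prop),
    lintegral_const_mul _ (by fun_prop), add_comm]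
  rcases hr.eq_or_lt with rfl | hr
  · simp [profile_of_nonpos, profileDeriv_of_nonpos]
  · rw [lintegral_exp_mul_profile_sq hv _ hr, lintegral_exp_mul_profileDeriv_sq hv hr,
      ENNReal.ofReal_mul (Real.exp_nonneg _), ← mul_assoc, ← ENNReal.ofReal_mul hc,
      add_sub_cancel_left]

end PhaseSpace

/-! ### The trial family: weak derivatives, Bessel bound and energy. -/

section TrialFamily

open Filter Topology FourierTransform
open scoped NNReal

variable {d q : ℕ}

/-- The plane wave of momentum `k` and spin `σ`. -/
noncomputable def planeWave (k : Space d) (σ : Fin q) (x : Space d) : EuclideanSpace ℂ (Fin q) :=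
  Complex.exp (↑(2 * Real.pi * inner ℝ x k) * Complex.I) • EuclideanSpace.single σ 1

theorem norm_planeWave (k : Space d) (σ : Fin q) (x : Space d) : ‖planeWave k σ x‖ = 1 := by
  rw [planeWave, norm_smul, Complex.norm_exp_ofReal_mul_I]
  simp

theorem contDiff_planeWave (k : Space d) (σ : Fin q) : ContDiff ℝ ∞ (planeWave k σ) := by
  unfold planeWave
  refine ContDiff.smul (ContDiff.cexp (ContDiff.mul ?_ contDiff_const)) contDiff_const
  exact Complex.ofRealCLM.contDiff.comp
    (contDiff_const.mul (contDiff_id.inner ℝ contDiff_const))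

theorem continuous_planeWave :
    Continuous fun p : (Space d × Fin q) × Space d => planeWave p.1.1 p.1.2 p.2 := by
  unfold planeWave
  have h : Continuous fun σ : Fin q => (EuclideanSpace.single σ 1 : EuclideanSpace ℂ (Fin q)) :=
    continuous_of_discreteTopology
  have h2 := h.comp (continuous_snd.comp (continuous_fst (X := Space d × Fin q) (Y := Space d)))
  have h1 : Continuous fun p : (Space d × Fin q) × Space d =>
      Complex.exp (↑(2 * Real.pi * inner ℝ p.2 p.1.1) * Complex.I) := by fun_prop
  exact h1.smul h2

theorem fderiv_planeWave (k : Space d) (σ : Fin q) (x : Space d) (j : Fin d) :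
    fderiv ℝ (planeWave k σ) x (EuclideanSpace.single j 1) =
      (↑(2 * Real.pi * k j) * Complex.I) • planeWave k σ x := by
  have h0 : HasFDerivAt (fun x : Space d => inner ℝ x k) (innerSL ℝ k) x := by
    have := (innerSL ℝ k).hasFDerivAt (x := x)
    refine this.congr_of_eventuallyEq (Eventually.of_forall fun y => ?_)
    simp [real_inner_comm]
  have h1 := ((Complex.ofRealCLM.hasFDerivAt.comp x (h0.const_mul (2 * Real.pi))).mul_const
    Complex.I).cexp.smul_const (EuclideanSpace.single σ (1 : ℂ))
  have h2 : fderiv ℝ (planeWave k σ) x = _ := h1.fderiv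
  rw [h2]
  simp [planeWave, smul_smul, EuclideanSpace.inner_single_right]
  ring_nf

variable {v : ℝ≥0}

/-- The trial family `√η(y - 2 log u(x)) e^{2πik·x} e_σ`. -/
noncomputable def trialFun (v : ℝ≥0) (u : Space d → ℝ) (a : (ℝ × Space d) × Fin q) (x : Space d) :
    EuclideanSpace ℂ (Fin q) :=
  profile v a.1.1 (u x) • planeWave a.1.2 a.2 x

/-- The weak partial derivative of `trialFun`, where `w` is that of `u`. -/
noncomputable def trialDeriv (v : ℝ≥0) (u w : Space d → ℝ) (j : Fin d)
    (a : (ℝ × Space d) × Fin q) (x : Space d) : EuclideanSpace ℂ (Fin q) :=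
  (profileDeriv v a.1.1 (u x) * w x) • planeWave a.1.2 a.2 x +
    profile v a.1.1 (u x) • ((↑(2 * Real.pi * a.1.2 j) * Complex.I) • planeWave a.1.2 a.2 x)

theorem enorm_trialFun_sq (u : Space d → ℝ) (a : (ℝ × Space d) × Fin q) (x : Space d) :
    ‖trialFun v u a x‖ₑ ^ 2 = ENNReal.ofReal (profile v a.1.1 (u x) ^ 2) := by
  rw [trialFun, ← ofReal_norm, norm_smul, norm_planeWave, mul_one,
    Real.norm_of_nonneg (profile_nonneg _ _), ← ENNReal.ofReal_pow (profile_nonneg _ _)]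

/-- Relative to the plane wave, the profile derivative contributes a real coefficient and the
momentum an imaginary one, so there is no cross term. -/
theorem enorm_trialDeriv_sq (u w : Space d → ℝ) (j : Fin d) (a : (ℝ × Space d) × Fin q)
    (x : Space d) :
    ‖trialDeriv v u w j a x‖ₑ ^ 2 =
      ENNReal.ofReal (profileDeriv v a.1.1 (u x) ^ 2) * ‖w x‖ₑ ^ 2 +
      ENNReal.ofReal (4 * Real.pi ^ 2 * a.1.2 j ^ 2) *
        ENNReal.ofReal (profile v a.1.1 (u x) ^ 2) := by
  set D := profileDeriv v a.1.1 (u x)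
  set P := profile v a.1.1 (u x)
  have h : trialDeriv v u w j a x =
      (↑(D * w x) + ↑(P * (2 * Real.pi * a.1.2 j)) * Complex.I : ℂ) • planeWave a.1.2 a.2 x := by
    rw [trialDeriv, add_smul, Complex.coe_smul, ← Complex.coe_smul P, smul_smul]
    congr 2
    push_cast
    ring
  rw [h, ← ofReal_norm, norm_smul, norm_planeWave, mul_one, ← ENNReal.ofReal_pow (norm_nonneg _),
    ← Complex.normSq_eq_norm_sq, Complex.normSq_add_mul_I, ← ofReal_norm (w x),
    ← ENNReal.ofReal_pow (norm_nonneg _), ← ENNReal.ofReal_mul (by positivity),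
    ← ENNReal.ofReal_mul (by positivity), ← ENNReal.ofReal_add (by positivity) (by positivity),
    Real.norm_eq_abs, sq_abs]
  congr 1
  ring

variable {u : Space d → ℝ} {w : Space d → ℝ}

theorem measurable_profile_comp (hu : Measurable u) (y : ℝ) :
    Measurable fun x => profile v y (u x) :=
  measurable_profile.comp (measurable_const.prodMk hu)

theorem stronglyMeasurable_trialFun (hu : Measurable u) :
    StronglyMeasurable fun p : ((ℝ × Space d) × Fin q) × Space d => trialFun v u p.1 p.2 := by
  have h1 : Measurable fun p : ((ℝ × Space d) × Fin q) × Space d =>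
      profile v p.1.1.1 (u p.2) := by
    have : Measurable fun p : ((ℝ × Space d) × Fin q) × Space d => (p.1.1.1, u p.2) := by fun_prop
    exact measurable_profile.comp this
  have h2 : Continuous fun p : ((ℝ × Space d) × Fin q) × Space d =>
      planeWave p.1.1.2 p.1.2 p.2 :=
    continuous_planeWave.comp (f := fun p : ((ℝ × Space d) × Fin q) × Space d =>
      ((p.1.1.2, p.1.2), p.2)) (by fun_prop)
  exact h1.stronglyMeasurable.smul h2.stronglyMeasurable

theorem stronglyMeasurable_trialDeriv (hu : Measurable u) (hw : Measurable w) (j : Fin d) :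
    StronglyMeasurable fun p : ((ℝ × Space d) × Fin q) × Space d => trialDeriv v u w j p.1 p.2 := by
  have h0 : Measurable fun p : ((ℝ × Space d) × Fin q) × Space d => (p.1.1.1, u p.2) := by fun_prop
  have h1 : Measurable fun p : ((ℝ × Space d) × Fin q) × Space d => profile v p.1.1.1 (u p.2) :=
    measurable_profile.comp h0
  have h1' : Measurable fun p : ((ℝ × Space d) × Fin q) × Space d =>
      profileDeriv v p.1.1.1 (u p.2) := measurable_profileDeriv.comp h0
  have h2 : Continuous fun p : ((ℝ × Space d) × Fin q) × Space d =>
      planeWave p.1.1.2 p.1.2 p.2 :=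
    continuous_planeWave.comp (f := fun p : ((ℝ × Space d) × Fin q) × Space d =>
      ((p.1.1.2, p.1.2), p.2)) (by fun_prop)
  have h3 : Continuous fun p : ((ℝ × Space d) × Fin q) × Space d =>
      (↑(2 * Real.pi * p.1.1.2 j) * Complex.I : ℂ) := by fun_prop
  have h4 : Measurable fun p : ((ℝ × Space d) × Fin q) × Space d =>
      profileDeriv v p.1.1.1 (u p.2) * w p.2 := h1'.mul (hw.comp measurable_snd)
  exact (h4.stronglyMeasurable.smul h2.stronglyMeasurable).add
    (h1.stronglyMeasurable.smul (h3.smul h2).stronglyMeasurable)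

/-- The linear bound `profile v y r ≤ K r` transfers square integrability from `u`. -/
theorem memLp_profile_comp (hv : v ≠ 0) (hu : Measurable u) (hu0 : ∀ x, 0 ≤ u x)
    (hu2 : MemLp u 2 volume) (y : ℝ) : MemLp (fun x => profile v y (u x)) 2 volume := by
  obtain ⟨K, hK, h⟩ := exists_profile_le_mul hv y 1
  refine hu2.of_le_mul (c := K) (measurable_profile_comp hu y).aestronglyMeasurable
    (Eventually.of_forall fun x => ?_)
  rw [Real.norm_of_nonneg (profile_nonneg _ _), Real.norm_of_nonneg (hu0 x)]
  rcases (hu0 x).eq_or_lt with h0 | h0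
  · rw [← h0, profile_of_nonpos le_rfl, mul_zero]
  · simpa using h _ h0

theorem memLp_trialFun (hv : v ≠ 0) (hu : Measurable u) (hu0 : ∀ x, 0 ≤ u x)
    (hu2 : MemLp u 2 volume) (a : (ℝ × Space d) × Fin q) : MemLp (trialFun v u a) 2 volume := by
  refine (memLp_profile_comp hv hu hu0 hu2 a.1.1).of_le
    ((stronglyMeasurable_trialFun hu).comp_measurable measurable_prodMk_left).aestronglyMeasurable
    (Eventually.of_forall fun x => ?_)
  rw [trialFun, norm_smul, norm_planeWave, mul_one]

theorem memLp_trialDeriv (hv : v ≠ 0) (hu : Measurable u) (hu0 : ∀ x, 0 ≤ u x)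
    (hu2 : MemLp u 2 volume) (hw : Measurable w) (hw2 : MemLp w 2 volume) (j : Fin d)
    (a : (ℝ × Space d) × Fin q) : MemLp (trialDeriv v u w j a) 2 volume := by
  obtain ⟨C, hC⟩ := exists_abs_profileDeriv_le hv a.1.1
  have h1 : Continuous (planeWave a.1.2 a.2) := (contDiff_planeWave a.1.2 a.2).continuous
  have h2 := measurable_profile_comp (v := v) hu a.1.1
  have h3 : Measurable fun x => profileDeriv v a.1.1 (u x) :=
    measurable_profileDeriv.comp (measurable_const.prodMk hu)
  have h4 : Continuous fun x =>
      (↑(2 * Real.pi * a.1.2 j) * Complex.I : ℂ) • planeWave a.1.2 a.2 x :=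
    h1.const_smul (↑(2 * Real.pi * a.1.2 j) * Complex.I : ℂ)
  refine MemLp.add (hw2.of_le_mul (c := C)
    ((h3.mul hw).aestronglyMeasurable.smul h1.aestronglyMeasurable)
    (Eventually.of_forall fun x => ?_))
    ((memLp_profile_comp hv hu hu0 hu2 a.1.1).of_le_mul
      (c := ‖(↑(2 * Real.pi * a.1.2 j) * Complex.I : ℂ)‖)
    (h2.aestronglyMeasurable.smul h4.aestronglyMeasurable)
    (Eventually.of_forall fun x => ?_))
  · rw [norm_smul, norm_planeWave, mul_one, norm_mul]
    exact mul_le_mul_of_nonneg_right (hC _) (norm_nonneg _)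
  · rw [norm_smul, norm_smul, norm_planeWave, mul_one, mul_comm]

theorem HasWeakPartialDeriv.congr_ae {F : Type*} [NormedAddCommGroup F] [NormedSpace ℝ F]
    {j : Fin d} {u v u' v' : Space d → F} (h : HasWeakPartialDeriv j u v) (hu : u =ᵐ[volume] u')
    (hv : v =ᵐ[volume] v') : HasWeakPartialDeriv j u' v' := by
  refine ⟨(locallyIntegrable_congr hu).1 h.locallyIntegrable,
    (locallyIntegrable_congr hv).1 h.locallyIntegrable_deriv, fun φ hφ hs => ?_⟩
  have e1 : ∫ x, (fderiv ℝ φ x (EuclideanSpace.single j 1)) • u' x =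
      ∫ x, (fderiv ℝ φ x (EuclideanSpace.single j 1)) • u x := by
    refine integral_congr_ae ?_
    filter_upwards [hu] with x hx
    rw [hx]
  have e2 : ∫ x, φ x • v' x = ∫ x, φ x • v x := by
    refine integral_congr_ae ?_
    filter_upwards [hv] with x hx
    rw [hx]
  rw [e1, e2, h.integral_eq φ hφ hs]

theorem hasWeakPartialDeriv_trialFun (hv : v ≠ 0) (hu : Measurable u) (hu0 : ∀ x, 0 ≤ u x)
    (hu2 : MemLp u 2 volume) (hw : Measurable w) (hw2 : MemLp w 2 volume) {j : Fin d}
    (h : HasWeakPartialDeriv j u w) (a : (ℝ × Space d) × Fin q) :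
    HasWeakPartialDeriv j (trialFun v u a) (trialDeriv v u w j a) := by
  obtain ⟨C, hC⟩ := exists_abs_profile_le hv a.1.1
  obtain ⟨C', hC'⟩ := exists_abs_profileDeriv_le hv a.1.1
  refine ⟨(memLp_trialFun hv hu hu0 hu2 a).locallyIntegrable (by norm_num),
    (memLp_trialDeriv hv hu hu0 hu2 hw hw2 j a).locallyIntegrable (by norm_num),
    fun φ hφ hs => ?_⟩
  have := integral_fderiv_smul_comp_smul h (contDiff_profile hv a.1.1) hC
    (by rwa [deriv_profile hv]) (contDiff_planeWave a.1.2 a.2) hφ hs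
  simp_rw [deriv_profile hv, fderiv_planeWave] at this
  exact this

theorem stronglyMeasurable_inner_toLp {Ω : Type*} [MeasurableSpace Ω]
    {f : Ω → Space d → EuclideanSpace ℂ (Fin q)}
    (hf : StronglyMeasurable fun p : Ω × Space d => f p.1 p.2)
    (hmem : ∀ a, MemLp (f a) 2 volume) (g : OneParticle d q) :
    StronglyMeasurable fun a => inner ℂ (hmem a).toLp g := by
  have h1 : StronglyMeasurable fun p : Ω × Space d => inner ℂ (f p.1 p.2) (g p.2) :=
    hf.inner ((Lp.stronglyMeasurable g).comp_measurable measurable_snd)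
  have h2 := h1.integral_prod_right' (ν := (volume : Measure (Space d)))
  have h3 : (fun a => inner ℂ (hmem a).toLp g) = fun a => ∫ x, inner ℂ (f a x) (g x) := by
    ext a
    rw [L2.inner_def]
    refine integral_congr_ae ?_
    filter_upwards [(hmem a).coeFn_toLp] with x hx
    rw [hx]
  rw [h3]
  exact h2

/-- The coefficients of `g` in the trial family are Fourier coefficients. -/
theorem inner_trialFun_toLp (a : (ℝ × Space d) × Fin q) (hmem : MemLp (trialFun v u a) 2 volume)
    (g : OneParticle d q) :
    inner ℂ hmem.toLp g = 𝓕 (fun x => (profile v a.1.1 (u x) : ℂ) * g x a.2) a.1.2 := by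
  rw [L2.inner_def, Real.fourier_eq']
  refine integral_congr_ae ?_
  filter_upwards [hmem.coeFn_toLp] with x hx
  rw [hx, trialFun, planeWave, ← Complex.coe_smul, smul_smul, inner_smul_left,
    EuclideanSpace.inner_single_left, map_mul, ← Complex.exp_conj]
  simp only [map_mul, Complex.conj_ofReal, Complex.conj_I, map_one, one_mul, smul_eq_mul]
  have : (↑(2 * Real.pi * inner ℝ x a.1.2) * -Complex.I : ℂ) =
      ↑(-2 * Real.pi * inner ℝ x a.1.2) * Complex.I := by
    push_cast; ring
  rw [this]
  ring

/-- This is the Pauli bound. Dropping the restriction to the Fermi balls makes the `k`-integral at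
fixed `y` and `σ` accessible to Plancherel; the squared profile then integrates in `y` to at most
one at every `x`. -/
theorem lintegral_inner_trialFun_sq_le (hv : v ≠ 0) (hu : Measurable u) (hu0 : ∀ x, 0 ≤ u x)
    (hu2 : MemLp u 2 volume) (g : OneParticle d q) :
    ∫⁻ a, ‖inner ℂ (memLp_trialFun hv hu hu0 hu2 a).toLp g‖ₑ ^ 2 ∂(phaseMeasure d q) ≤
      ‖g‖ₑ ^ 2 := by
  set I : (ℝ × Space d) × Fin q → ℝ≥0∞ := fun a =>
    ‖inner ℂ (memLp_trialFun hv hu hu0 hu2 a).toLp g‖ₑ ^ 2 with hI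
  have hImeas : Measurable I := ((stronglyMeasurable_inner_toLp
    (stronglyMeasurable_trialFun hu) (memLp_trialFun hv hu hu0 hu2) g).measurable.enorm).pow_const 2
  have hgm : Measurable (g : Space d → EuclideanSpace ℂ (Fin q)) := (Lp.stronglyMeasurable g).measurable
  have hgσ : ∀ σ, Measurable fun x => g x σ := fun σ =>
    (EuclideanSpace.proj (𝕜 := ℂ) σ).continuous.measurable.comp hgm
  have hgL : ∀ σ, MemLp (fun x => g x σ) 2 volume := fun σ =>
    (Lp.memLp g).of_le (hgσ σ).aestronglyMeasurable
      (Eventually.of_forall fun x => PiLp.norm_apply_le _ _)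
  have hplanch : ∀ (y : ℝ) (σ : Fin q), ∫⁻ k, I ((y, k), σ) =
      ∫⁻ x, ENNReal.ofReal (profile v y (u x) ^ 2) * ‖g x σ‖ₑ ^ 2 := fun y σ => by
    simp only [hI, inner_trialFun_toLp]
    have hP : MemLp (fun x => (profile v y (u x) : ℂ)) 2 volume :=
      (memLp_profile_comp hv hu hu0 hu2 y).ofReal
    obtain ⟨C, hC⟩ := exists_abs_profile_le hv y
    have hm : AEStronglyMeasurable (fun x => (profile v y (u x) : ℂ) * g x σ) volume :=
      hP.aestronglyMeasurable.mul (hgσ σ).aestronglyMeasurable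
    have hi : Integrable (fun x => (profile v y (u x) : ℂ) * g x σ) volume :=
      hP.integrable_mul (hgL σ)
    rw [lintegral_enorm_fourier_sq hi
      ((hgL σ).of_le_mul (c := C) hm (Eventually.of_forall fun x => ?_))]
    · refine lintegral_congr fun x => ?_
      rw [enorm_mul, mul_pow, ← ofReal_norm, Complex.norm_real,
        Real.norm_of_nonneg (profile_nonneg _ _), ← ENNReal.ofReal_pow (profile_nonneg _ _)]
    · rw [norm_mul, Complex.norm_real]
      exact mul_le_mul_of_nonneg_right (hC _) (norm_nonneg _)
  have hmeas2 : ∀ σ, Measurable fun p : ℝ × Space d =>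
      ENNReal.ofReal (profile v p.1 (u p.2) ^ 2) * ‖g p.2 σ‖ₑ ^ 2 := fun σ => by
    have h1 : Measurable fun p : ℝ × Space d => profile v p.1 (u p.2) :=
      measurable_profile.comp (measurable_fst.prodMk (hu.comp measurable_snd))
    have h2 : Measurable fun p : ℝ × Space d => ‖g p.2 σ‖ₑ :=
      ((hgσ σ).comp measurable_snd).enorm
    exact (h1.pow_const 2).ennreal_ofReal.mul (h2.pow_const 2)
  have hprof : ∀ x, ∫⁻ y, ENNReal.ofReal (profile v y (u x) ^ 2) ≤ 1 := fun x => by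
    rcases (hu0 x).eq_or_lt with h0 | h0
    · simp [← h0, profile_of_nonpos]
    · exact (lintegral_profile_sq hv h0).le
  calc ∫⁻ a, I a ∂(phaseMeasure d q)
      = ∫⁻ z in fermiRegion d q, ∑ σ, I (z, σ) := by
        rw [phaseMeasure, lintegral_prod _ hImeas.aemeasurable]
        simp_rw [lintegral_count, tsum_fintype]
    _ ≤ ∫⁻ z, ∑ σ, I (z, σ) := setLIntegral_le_lintegral _ _
    _ = ∑ σ, ∫⁻ z, I (z, σ) :=
        lintegral_finsetSum _ fun σ _ => hImeas.comp measurable_prodMk_right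
    _ = ∑ σ, ∫⁻ y, ∫⁻ k, I ((y, k), σ) := by
        refine Finset.sum_congr rfl fun σ _ => ?_
        rw [Measure.volume_eq_prod]
        exact lintegral_prod (fun z => I (z, σ)) (hImeas.comp measurable_prodMk_right).aemeasurable
    _ = ∑ σ, ∫⁻ x, ∫⁻ y, ENNReal.ofReal (profile v y (u x) ^ 2) * ‖g x σ‖ₑ ^ 2 := by
        simp_rw [hplanch]
        exact Finset.sum_congr rfl fun σ _ => lintegral_lintegral_swap (hmeas2 σ).aemeasurable
    _ ≤ ∑ σ, ∫⁻ x, ‖g x σ‖ₑ ^ 2 := by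
        refine Finset.sum_le_sum fun σ _ => lintegral_mono fun x => ?_
        rw [lintegral_mul_const' _ _ (by finiteness)]
        exact mul_le_of_le_one_left zero_le (hprof x)
    _ = ∫⁻ x, ∑ σ, ‖g x σ‖ₑ ^ 2 :=
        (lintegral_finsetSum _ fun σ _ => ((hgσ σ).enorm.pow_const 2)).symm
    _ = ‖g‖ₑ ^ 2 := by
        rw [Lp.enorm_sq_eq_lintegral]
        refine lintegral_congr fun x => ?_
        rw [← ofReal_norm (g x), ← ENNReal.ofReal_pow (norm_nonneg _), EuclideanSpace.norm_sq_eq,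
          ENNReal.ofReal_sum_of_nonneg fun σ _ => by positivity]
        refine Finset.sum_congr rfl fun σ _ => ?_
        rw [← ofReal_norm, ENNReal.ofReal_pow (norm_nonneg _)]

/-- The upper bound for a measurable `√ρ = u` with the bandwidth `v` of the trial state. -/
theorem lowestKineticEnergy_sq_le (hd : 1 ≤ d) (hq : 1 ≤ q) (hv : v ≠ 0) (hu : Measurable u)
    (hu0 : ∀ x, 0 ≤ u x) (hu2 : MemLp u 2 volume) {w : Fin d → Space d → ℝ}
    (hw : ∀ j, Measurable (w j)) (hw2 : ∀ j, MemLp (w j) 2 volume)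
    (h : ∀ j, HasWeakPartialDeriv j u (w j))
    (hI : ∫⁻ x, ENNReal.ofReal (u x ^ (2 * (1 + 2 / (d : ℝ)))) < ⊤) :
    lowestKineticEnergy q (fun x => u x ^ 2) ≤
      ENNReal.ofReal ((q : ℝ) ^ (-(2 / (d : ℝ))) * cTF d *
          Real.exp ((1 + 2 / (d : ℝ)) * (2 / (d : ℝ)) * v / 2)) *
        (∫⁻ x, ENNReal.ofReal (u x ^ (2 * (1 + 2 / (d : ℝ))))) +
      ENNReal.ofReal (1 + 1 / v) * ∑ j, ∫⁻ x, ‖w j x‖ₑ ^ 2 := by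
  set Ψ : (ℝ × Space d) × Fin q → OneParticle d q := fun a =>
    (memLp_trialFun hv hu hu0 hu2 a).toLp with hΨ
  set Ψ' : Fin d → (ℝ × Space d) × Fin q → OneParticle d q := fun j a =>
    (memLp_trialDeriv hv hu hu0 hu2 (hw j) (hw2 j) j a).toLp with hΨ'
  have hΨnorm : ∀ (s : Set (Space d)) a, ∫⁻ x in s, ‖Ψ a x‖ₑ ^ 2 =
      ∫⁻ x in s, ENNReal.ofReal (profile v a.1.1 (u x) ^ 2) := fun s a => by
    refine lintegral_congr_ae (ae_restrict_of_ae ?_)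
    filter_upwards [(memLp_trialFun hv hu hu0 hu2 a).coeFn_toLp] with x hx
    rw [hΨ, hx, enorm_trialFun_sq]
  have hm0 : Measurable fun p : ((ℝ × Space d) × Fin q) × Space d => (p.1.1.1, u p.2) := by fun_prop
  have hm1 : Measurable fun p : ((ℝ × Space d) × Fin q) × Space d =>
      ENNReal.ofReal (profile v p.1.1.1 (u p.2) ^ 2) :=
    ((measurable_profile.comp hm0).pow_const 2).ennreal_ofReal
  have hm2 : Measurable fun p : ((ℝ × Space d) × Fin q) × Space d =>
      ENNReal.ofReal (profileDeriv v p.1.1.1 (u p.2) ^ 2) :=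
    ((measurable_profileDeriv.comp hm0).pow_const 2).ennreal_ofReal
  have hdens : ∀ s : Set (Space d), MeasurableSet s →
      ∫⁻ a, (∫⁻ x in s, ‖Ψ a x‖ₑ ^ 2) ∂(phaseMeasure d q) =
        ∫⁻ x in s, ENNReal.ofReal (u x ^ 2) := fun s _ => by
    simp_rw [hΨnorm]
    rw [lintegral_lintegral_swap hm1.aemeasurable]
    simp_rw [lintegral_phaseMeasure_profile_sq hd hq hv (hu0 _)]
  have hΨ'norm : ∀ j a, ‖Ψ' j a‖ₑ ^ 2 = ∫⁻ x, ‖trialDeriv v u (w j) j a x‖ₑ ^ 2 := fun j a => by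
    rw [Lp.enorm_sq_eq_lintegral]
    refine lintegral_congr_ae ?_
    filter_upwards [(memLp_trialDeriv hv hu hu0 hu2 (hw j) (hw2 j) j a).coeFn_toLp] with x hx
    rw [hΨ', hx]
  have hmd : ∀ j, Measurable fun p : ((ℝ × Space d) × Fin q) × Space d =>
      ‖trialDeriv v u (w j) j p.1 p.2‖ₑ ^ 2 := fun j =>
    ((stronglyMeasurable_trialDeriv hu (hw j) j).measurable.enorm).pow_const 2
  have henergy : ∑ j, ∫⁻ a, ‖Ψ' j a‖ₑ ^ 2 ∂(phaseMeasure d q) ≤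
      ENNReal.ofReal ((q : ℝ) ^ (-(2 / (d : ℝ))) * cTF d *
          Real.exp ((1 + 2 / (d : ℝ)) * (2 / (d : ℝ)) * v / 2)) *
        (∫⁻ x, ENNReal.ofReal (u x ^ (2 * (1 + 2 / (d : ℝ))))) +
      ENNReal.ofReal (1 + 1 / v) * ∑ j, ∫⁻ x, ‖w j x‖ₑ ^ 2 := by
    have hwm : ∀ j, Measurable fun x => ‖w j x‖ₑ ^ 2 := fun j => (hw j).enorm.pow_const 2
    have hsum : ∀ (a : (ℝ × Space d) × Fin q) x, ∑ j, ‖trialDeriv v u (w j) j a x‖ₑ ^ 2 =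
        ENNReal.ofReal (profileDeriv v a.1.1 (u x) ^ 2) * (∑ j, ‖w j x‖ₑ ^ 2) +
        ENNReal.ofReal (4 * Real.pi ^ 2 * ‖a.1.2‖ ^ 2) *
          ENNReal.ofReal (profile v a.1.1 (u x) ^ 2) := fun a x => by
      simp_rw [enorm_trialDeriv_sq]
      rw [Finset.sum_add_distrib, ← Finset.mul_sum, ← Finset.sum_mul,
        ← ENNReal.ofReal_sum_of_nonneg fun j _ => by positivity, ← Finset.mul_sum,
        EuclideanSpace.norm_sq_eq]
      simp_rw [Real.norm_eq_abs, sq_abs]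
    calc ∑ j, ∫⁻ a, ‖Ψ' j a‖ₑ ^ 2 ∂(phaseMeasure d q)
        = ∑ j, ∫⁻ x, ∫⁻ a, ‖trialDeriv v u (w j) j a x‖ₑ ^ 2 ∂(phaseMeasure d q) := by
          simp_rw [hΨ'norm]
          exact Finset.sum_congr rfl fun j _ => lintegral_lintegral_swap (hmd j).aemeasurable
      _ = ∫⁻ x, ∑ j, ∫⁻ a, ‖trialDeriv v u (w j) j a x‖ₑ ^ 2 ∂(phaseMeasure d q) :=
          (lintegral_finsetSum _ fun j _ => (hmd j).lintegral_prod_left').symm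
      _ = ∫⁻ x, ∫⁻ a, ∑ j, ‖trialDeriv v u (w j) j a x‖ₑ ^ 2 ∂(phaseMeasure d q) :=
          lintegral_congr fun x => (lintegral_finsetSum _ fun j _ =>
            (hmd j).comp measurable_prodMk_right).symm
      _ ≤ ∫⁻ x, (ENNReal.ofReal ((q : ℝ) ^ (-(2 / (d : ℝ))) * cTF d *
          Real.exp ((1 + 2 / (d : ℝ)) * (2 / (d : ℝ)) * v / 2)) *
          ENNReal.ofReal (u x ^ (2 * (1 + 2 / (d : ℝ)))) +
          ENNReal.ofReal (1 + 1 / v) * ∑ j, ‖w j x‖ₑ ^ 2) := by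
          refine lintegral_mono fun x => ?_
          simp_rw [hsum]
          exact lintegral_phaseMeasure_energy_le hd hq hv (hu0 x) _
      _ = _ := by
          rw [lintegral_add_left (by fun_prop), lintegral_const_mul _ (by fun_prop),
            lintegral_const_mul _ (Finset.measurable_fun_sum _ fun j _ => hwm j),
            lintegral_finsetSum _ fun j _ => hwm j]
  -- Each derivative integral is one term of the energy just bounded, so it is finite because `hI`
  -- and the `L²` gradient make the bound finite.
  have hfin' : ∀ j, ∫⁻ a, ‖Ψ' j a‖ₑ ^ 2 ∂(phaseMeasure d q) < ⊤ := fun j => by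
    have hwfin : ∀ j, ∫⁻ x, ‖w j x‖ₑ ^ 2 < ⊤ := fun j => by
      have := (hw2 j).2
      rw [eLpNorm_lt_top_iff_lintegral_rpow_enorm_lt_top (by simp) (by simp)] at this
      simpa using this
    refine lt_of_le_of_lt ((Finset.single_le_sum (f := fun j =>
      ∫⁻ a, ‖Ψ' j a‖ₑ ^ 2 ∂(phaseMeasure d q)) (fun _ _ => zero_le) (Finset.mem_univ j)).trans
        henergy) ?_
    exact ENNReal.add_lt_top.2 ⟨ENNReal.mul_lt_top ENNReal.ofReal_lt_top hI,
      ENNReal.mul_lt_top ENNReal.ofReal_lt_top (ENNReal.sum_lt_top.2 fun j _ => hwfin j)⟩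
  have hfin : ∫⁻ a, ‖Ψ a‖ₑ ^ 2 ∂(phaseMeasure d q) < ⊤ := by
    have := hdens Set.univ MeasurableSet.univ
    simp only [Measure.restrict_univ, ← Lp.enorm_sq_eq_lintegral] at this
    rw [this]
    exact hu2.integrable_sq.lintegral_lt_top
  refine (lowestKineticEnergy_le_of_family (μ := phaseMeasure d q) (by fun_prop) Ψ Ψ'
    (fun g => ?_) (fun j g => ?_) hfin hfin' (fun j a => ?_)
    (lintegral_inner_trialFun_sq_le hv hu hu0 hu2) hdens).trans henergy
  · exact (stronglyMeasurable_inner_toLp (stronglyMeasurable_trialFun hu)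
      (memLp_trialFun hv hu hu0 hu2) g).aestronglyMeasurable
  · exact (stronglyMeasurable_inner_toLp (stronglyMeasurable_trialDeriv hu (hw j) j)
      (memLp_trialDeriv hv hu hu0 hu2 (hw j) (hw2 j) j) g).aestronglyMeasurable
  · exact (hasWeakPartialDeriv_trialFun hv hu hu0 hu2 (hw j) (hw2 j) (h j) a).congr_ae
      (memLp_trialFun hv hu hu0 hu2 a).coeFn_toLp.symm
      (memLp_trialDeriv hv hu hu0 hu2 (hw j) (hw2 j) j a).coeFn_toLp.symm

end TrialFamily

/-! ### Choice of the variance and the final bound. -/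

section UpperBound

open scoped NNReal

variable {d q : ℕ}

theorem lowestKineticEnergy_congr_ae {ρ ρ' : Space d → ℝ} (h : ρ =ᵐ[volume] ρ') :
    lowestKineticEnergy q ρ = lowestKineticEnergy q ρ' := by
  have e : (fun x => ENNReal.ofReal (ρ x)) =ᵐ[volume] fun x => ENNReal.ofReal (ρ' x) := by
    filter_upwards [h] with x hx
    rw [hx]
  have hiff : ∀ γ : OneParticle d q →L[ℂ] OneParticle d q,
      (density γ =ᵐ[volume] fun x => ENNReal.ofReal (ρ x)) ↔
        (density γ =ᵐ[volume] fun x => ENNReal.ofReal (ρ' x)) := fun γ =>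
    ⟨fun h' => h'.trans e, fun h' => h'.trans e.symm⟩
  unfold lowestKineticEnergy
  simp_rw [hiff]

theorem cTF_pos (hd : 1 ≤ d) : 0 < cTF d := by
  have hB := volume_unitBall_pos (d := d)
  have hd' : (0 : ℝ) < d := by positivity
  rw [cTF, sphereArea_eq]
  positivity

/-- From `e^t (1 - t) ≤ 1` one gets `e^t ≤ 1 + t e^t`. Cutting off at one keeps `t ≤ A`, so the
bound stays linear in `ε` for all `ε`. -/
theorem exp_mul_min_le {A ε : ℝ} (hA : 0 ≤ A) (hε : 0 < ε) :
    Real.exp (A * min ε 1) ≤ 1 + A * Real.exp A * ε := by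
  set t := A * min ε 1
  have ht0 : 0 ≤ t := by positivity
  have htA : t ≤ A := mul_le_of_le_one_right hA (min_le_right _ _)
  have htε : t ≤ A * ε := mul_le_mul_of_nonneg_left (min_le_left _ _) hA
  have h1 : Real.exp t * (1 - t) ≤ 1 := by
    calc Real.exp t * (1 - t) ≤ Real.exp t * Real.exp (-t) := by
          refine mul_le_mul_of_nonneg_left ?_ (Real.exp_nonneg _)
          linarith [Real.add_one_le_exp (-t)]
      _ = 1 := by rw [← Real.exp_add, add_neg_cancel, Real.exp_zero]
  calc Real.exp t ≤ 1 + t * Real.exp t := by linarith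
    _ ≤ 1 + (A * ε) * Real.exp A := by gcongr
    _ = _ := by ring

theorem one_add_inv_min_le {ε : ℝ} (hε : 0 < ε) :
    1 + 1 / min ε 1 ≤ 2 * (1 + √ε) ^ 2 / ε := by
  have hs := Real.sq_sqrt hε.le
  have hs0 := Real.sqrt_nonneg ε
  rw [le_div_iff₀ hε]
  rcases le_total ε 1 with h | h
  · rw [min_eq_left h]
    have : (1 + 1 / ε) * ε = ε + 1 := by field_simp
    rw [this]
    nlinarith
  · rw [min_eq_right h]
    nlinarith

/-- The upper bound for a given weak gradient `w` of `√ρ`. -/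
theorem lowestKineticEnergy_le_of_weakGradient (hd : 1 ≤ d) (hq : 1 ≤ q) {ρ : Space d → ℝ}
    (hρ0 : ∀ᵐ x, 0 ≤ ρ x) (hρ2 : MemLp (fun x => Real.sqrt (ρ x)) 2 volume)
    {w : Fin d → Space d → ℝ} (hw : ∀ j, HasWeakPartialDeriv j (fun x => Real.sqrt (ρ x)) (w j))
    {ε : ℝ} (hε : 0 < ε) :
    lowestKineticEnergy q ρ ≤
      ENNReal.ofReal ((q : ℝ) ^ (-(2 / (d : ℝ))) * cTF d *
        (1 + ((1 + 2 / (d : ℝ)) * (2 / (d : ℝ)) / 2) *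
          Real.exp ((1 + 2 / (d : ℝ)) * (2 / (d : ℝ)) / 2) * ε)) *
          (∫⁻ x, ENNReal.ofReal (ρ x ^ (1 + 2 / (d : ℝ)))) +
        ENNReal.ofReal (2 * (1 + Real.sqrt ε) ^ 2 / ε) * ∑ j, ∫⁻ x, ‖w j x‖ₑ ^ 2 := by
  have hc := cTF_pos hd
  have hd' : (0 : ℝ) < d := by positivity
  have hq' : (0 : ℝ) < q := by positivity
  set A := (1 + 2 / (d : ℝ)) * (2 / (d : ℝ)) / 2 with hAdef
  have hA : 0 < A := by positivity
  -- Both coefficients on the right are strictly positive, so an infinite integral makes the bound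
  -- trivial. Otherwise the finiteness needed by the trial state is available.
  by_cases hI : ∫⁻ x, ENNReal.ofReal (ρ x ^ (1 + 2 / (d : ℝ))) = ⊤
  · rw [hI, ENNReal.mul_top, top_add]
    · exact le_top
    · exact (ENNReal.ofReal_pos.2 (by positivity)).ne'
  by_cases hE : ∑ j, ∫⁻ x, ‖w j x‖ₑ ^ 2 = ⊤
  · rw [hE, ENNReal.mul_top, add_top]
    · exact le_top
    · exact (ENNReal.ofReal_pos.2 (by positivity)).ne'
  have hum := hρ2.aestronglyMeasurable
  set u : Space d → ℝ := fun x => |hum.mk _ x| with hudef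
  have hu : Measurable u := hum.stronglyMeasurable_mk.measurable.abs
  have hu0 : ∀ x, 0 ≤ u x := fun x => abs_nonneg _
  have hae : (fun x => Real.sqrt (ρ x)) =ᵐ[volume] u := by
    filter_upwards [hum.ae_eq_mk] with x hx
    rw [hudef]
    simp only
    rw [← hx, abs_of_nonneg (Real.sqrt_nonneg _)]
  have hwm := fun j => (hw j).locallyIntegrable_deriv.aestronglyMeasurable
  set w' : Fin d → Space d → ℝ := fun j => (hwm j).mk _ with hw'def
  have hwe : ∀ j, w j =ᵐ[volume] w' j := fun j => (hwm j).ae_eq_mk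
  have hwE : ∀ j, ∫⁻ x, ‖w' j x‖ₑ ^ 2 = ∫⁻ x, ‖w j x‖ₑ ^ 2 := fun j => by
    refine lintegral_congr_ae ?_
    filter_upwards [hwe j] with x hx
    rw [hx]
  have hρu : ρ =ᵐ[volume] fun x => u x ^ 2 := by
    filter_upwards [hae, hρ0] with x hx h0
    rw [← hx, Real.sq_sqrt h0]
  have hIu : ∫⁻ x, ENNReal.ofReal (u x ^ (2 * (1 + 2 / (d : ℝ)))) =
      ∫⁻ x, ENNReal.ofReal (ρ x ^ (1 + 2 / (d : ℝ))) := by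
    refine lintegral_congr_ae ?_
    filter_upwards [hρu] with x hx
    rw [hx, Real.rpow_mul (hu0 x), Real.rpow_two]
  have hmin : 0 < min ε 1 := lt_min hε one_pos
  -- The variance is of order `ε` for small `ε`, balancing `e^{Av} - 1 ≲ ε` against `1/v`, and is
  -- capped at one so that the exponential does not outgrow a linear function of `ε`.
  set v : ℝ≥0 := ⟨min ε 1, hmin.le⟩ with hvdef
  have hvc : (v : ℝ) = min ε 1 := rfl
  have hv : v ≠ 0 := fun h => hmin.ne' (by rw [← hvc, h]; rfl)
  have hw2 : ∀ j, MemLp (w' j) 2 volume := fun j =>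
    memLp_two_of_lintegral_lt_top (hwm j).stronglyMeasurable_mk.aestronglyMeasurable (by
      rw [hwE]
      exact ENNReal.sum_lt_top.1 (lt_top_iff_ne_top.2 hE) j (Finset.mem_univ j))
  have key := lowestKineticEnergy_sq_le hd hq hv hu hu0 ((memLp_congr_ae hae).1 hρ2)
    (fun j => (hwm j).stronglyMeasurable_mk.measurable) hw2
    (fun j => (hw j).congr_ae hae (hwe j)) (by rw [hIu]; exact lt_top_iff_ne_top.2 hI)
  rw [hIu, ← lowestKineticEnergy_congr_ae hρu] at key
  have hsum : ∑ j, ∫⁻ x, ‖w' j x‖ₑ ^ 2 = ∑ j, ∫⁻ x, ‖w j x‖ₑ ^ 2 :=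
    Finset.sum_congr rfl fun j _ => hwE j
  refine key.trans ?_
  rw [hsum]
  gcongr
  · rw [hvc, show (1 + 2 / (d : ℝ)) * (2 / (d : ℝ)) * min ε 1 / 2 = A * min ε 1 by
      rw [hAdef]; ring]
    exact exp_mul_min_le hA.le hε
  · rw [hvc]
    exact one_add_inv_min_le hε

end UpperBound

theorem theorem3 (d : ℕ) (hd : 1 ≤ d) :
    ∃ κ₁ κ₂ : ℝ, 0 < κ₁ ∧ 0 < κ₂ ∧
      ∀ (q : ℕ), 1 ≤ q →
      ∀ ρ : Space d → ℝ, Integrable ρ volume → (∀ᵐ x, 0 ≤ ρ x) →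
        MemH1 (fun x => Real.sqrt (ρ x)) →
      ∀ ε : ℝ, 0 < ε →
        lowestKineticEnergy q ρ ≤
          ENNReal.ofReal ((q : ℝ) ^ (-(2 / (d : ℝ))) * cTF d * (1 + κ₁ * ε)) *
              (∫⁻ x, ENNReal.ofReal (ρ x ^ (1 + 2 / (d : ℝ))))
            + ENNReal.ofReal (κ₂ * (1 + Real.sqrt ε) ^ 2 / ε) *
              dirichletEnergy (fun x => Real.sqrt (ρ x)) := by
  have hd' : (0 : ℝ) < d := by positivity
  -- `κ₁ = A e^A` with `A = (1 + 2/d)(2/d)/2`, half of `p(p-1)` at `p = 1 + 2/d`.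
  refine ⟨(1 + 2 / (d : ℝ)) * (2 / (d : ℝ)) / 2 * Real.exp ((1 + 2 / (d : ℝ)) * (2 / (d : ℝ)) / 2),
    2, by positivity, two_pos, fun q hq ρ _ hρ0 hH1 ε hε => ?_⟩
  have hc : ENNReal.ofReal (2 * (1 + Real.sqrt ε) ^ 2 / ε) ≠ 0 :=
    (ENNReal.ofReal_pos.2 (by positivity)).ne'
  -- The Dirichlet energy is an infimum over weak gradients. It is isolated on the right-hand side
  -- so that the bound can be proved for each weak gradient separately.
  rw [← tsub_le_iff_left, mul_comm (ENNReal.ofReal (2 * _ / ε)),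
    ← ENNReal.div_le_iff_le_mul (Or.inl hc) (Or.inl ENNReal.ofReal_ne_top)]
  refine le_iInf₂ fun w hw => ?_
  rw [ENNReal.div_le_iff_le_mul (Or.inl hc) (Or.inl ENNReal.ofReal_ne_top), tsub_le_iff_left,
    mul_comm (∑ j, _)]
  exact lowestKineticEnergy_le_of_weakGradient hd hq hρ0 hH1.1 hw hε
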